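/- Let $\mathcal H\neq\{0\}$ be a separable (real or complex) Hilbert space and let $\mathbf C$ be a bounded linear operator on $\mathcal H$ that is accretive, i.e. $\operatorname{Re}\langle \mathbf Cx,x\rangle\ge 0$ for all $x\in\mathcal H$. Put $\mathbf C_H=\tfrac12(\mathbf C+\mathbf C^*)\ge 0$, let $\sqrt{\mathbf C_H}$ be its nonnegative square root, let $\mathbf P(t)=e^{-\mathbf Ct}$ with operator norm $\|\mathbf P(t)\|$, and let $\mathbb S=\{x\in\mathcal H:\|x\|=1\}$. The hypocoercivity index $m_{HC}$ of $\mathbf C$ is the smallest $m\in\mathbb N_0$ (if one exists) such that $\sum_{j=0}^m(\mathbf C^*)^j\mathbf C_H\mathbf C^j\ge\kappa\mathbf I$ for some $\kappa>0$. The operator $\mathbf C$ is called hypocoercive if $(\mathbf P(t))_{t\ge0}$ is uniformly exponentially stable, i.e. $\lim_{t\to\infty}e^{\varepsilon t}\|\mathbf P(t)\|=0$ for some $\varepsilon>0$. (a) Suppose that $\mathbf C$ has hypocoercivity index $m_{HC}\in\mathbb N_0$ and let $a=2m_{HC}+1$. Then the limit in $$c:=\frac{\lim_{\delta\to0^+}\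 \inf\big\{\|\sqrt{\mathbf C_H}\,\mathbf C^{m_{HC}}x\|^2:\ x\in\mathbb S,\ \|\sqrt{\mathbf C_H}\,\mathbf C^{j}x\|^2\le\delta\ \text{ for } j=0,\dots,m_{HC}-1\big\}}{(2m_{HC}+1)!\,\binom{2m_{HC}}{m_{HC}}}$$ exists and is finite, and there are constants $c_1\ge c\ge c_2>0$, $C_1,C_2\ge0$ and $t_0>0$ such that $$1-c_1t^a-C_1t^{a+1}\le\|\mathbf P(t)\|\le1-c_2t^a+C_2t^{a+1}\qquad\text{for all }t\in[0,t_0].$$ Moreover, $\|\mathbf P(t)\|=1-c\,t^a+o(t^a)$ as $t\to0^+$. (b) Conversely, if $\|\mathbf P(t)\|=1-c\,t^a+o(t^a)$ as $t\to0^+$ for some real constants $c>0$ and $a>0$, then $a$ is an odd positive integer, $\mathbf C$ is hypocoercive, and its hypocoercivity index is $m_{HC}=\frac{a-1}{2}\in\mathbb N_0$. -/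

import Mathlib

open Filter Topology ContinuousLinearMap

namespace Hypocoercivity

variable {𝕜 H : Type*} [RCLike 𝕜] [NormedAddCommGroup H] [InnerProductSpace 𝕜 H] [CompleteSpace H]

/-- The iteration `Y ↦ (B + Y ^ 2) / 2` converges for a self-adjoint `B` of norm at most one. -/
theorem exists_fixedPoint (𝕜 : Type*) {𝔸 : Type*} [RCLike 𝕜] [NormedRing 𝔸] [StarRing 𝔸]
    [ContinuousStar 𝔸] [NormedAlgebra 𝕜 𝔸] [StarModule 𝕜 𝔸] [CompleteSpace 𝔸]
    (B : 𝔸) (hBs : IsSelfAdjoint B) (hB1 : ‖B‖ ≤ 1) :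
    ∃ Y : 𝔸, IsSelfAdjoint Y ∧ ‖Y‖ ≤ 1 ∧ Y + Y = B + Y * Y := by
  obtain ⟨y, hy0, hy1⟩ : ∃ y : ℕ → 𝔸, y 0 = 0 ∧
      ∀ n, y (n + 1) = (2⁻¹ : 𝕜) • (B + y n * y n) :=
    ⟨fun n => Nat.rec 0 (fun _ Y => (2⁻¹ : 𝕜) • (B + Y * Y)) n, rfl, fun _ => rfl⟩
  obtain ⟨s, hs0, hs1⟩ : ∃ s : ℕ → ℝ, s 0 = 0 ∧ ∀ n, s (n + 1) = 2⁻¹ * (1 + s n * s n) :=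
    ⟨fun n => Nat.rec 0 (fun _ r => 2⁻¹ * (1 + r * r)) n, rfl, fun _ => rfl⟩
  have hhalf : ‖(2⁻¹ : 𝕜)‖ = 2⁻¹ := by rw [norm_inv, RCLike.norm_ofNat]
  have hs : ∀ n, 0 ≤ s n ∧ s n ≤ 1 := by
    intro n
    induction n with
    | zero => simp [hs0]
    | succ k ih =>
      rw [hs1]
      constructor <;> nlinarith [ih.1, ih.2]
  have hyn : ∀ n, ‖y n‖ ≤ s n := by
    intro n
    induction n with
    | zero => simp [hy0, hs0]
    | succ k ih =>
      rw [hy1, hs1, norm_smul, hhalf]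
      have h1 : ‖B + y k * y k‖ ≤ 1 + s k * s k :=
        (norm_add_le _ _).trans (add_le_add hB1 ((norm_mul_le _ _).trans
          (mul_le_mul ih ih (norm_nonneg _) (hs k).1)))
      linarith
  have hd : ∀ n, ‖y (n + 1) - y n‖ ≤ s (n + 1) - s n := by
    intro n
    induction n with
    | zero => simpa [hy0, hs0] using hyn 1
    | succ k ih =>
      have e : y (k + 1 + 1) - y (k + 1) = (2⁻¹ : 𝕜) •
          (y (k + 1) * (y (k + 1) - y k) + (y (k + 1) - y k) * y k) := by
        have e1 := hy1 (k + 1)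
        have e2 := hy1 k
        calc y (k + 1 + 1) - y (k + 1)
            = (2⁻¹ : 𝕜) • (B + y (k + 1) * y (k + 1)) - (2⁻¹ : 𝕜) • (B + y k * y k) := by
              rw [← e1, ← e2]
          _ = _ := by
              rw [← smul_sub]
              congr 1
              noncomm_ring
      have h3 : ‖y (k + 1) * (y (k + 1) - y k) + (y (k + 1) - y k) * y k‖
          ≤ s (k + 1) * (s (k + 1) - s k) + (s (k + 1) - s k) * s k := by
        refine (norm_add_le _ _).trans (add_le_add ((norm_mul_le _ _).trans ?_)
          ((norm_mul_le _ _).trans ?_))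
        · exact mul_le_mul (hyn _) ih (norm_nonneg _) (hs _).1
        · exact mul_le_mul ih (hyn _) (norm_nonneg _) ((norm_nonneg _).trans ih)
      rw [e, norm_smul, hhalf]
      have e1 := hs1 (k + 1)
      have e2 := hs1 k
      nlinarith
  have hsum : Summable fun n => s (n + 1) - s n := by
    refine summable_of_sum_range_le (c := 1) (fun n => (norm_nonneg _).trans (hd n)) fun n => ?_
    rw [Finset.sum_range_sub]
    linarith [(hs n).2, (hs 0).1]
  have hc : CauchySeq y :=
    cauchySeq_of_dist_le_of_summable (fun n => s (n + 1) - s n)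
      (fun n => by rw [dist_comm, dist_eq_norm]; exact hd n) hsum
  obtain ⟨Y, hY⟩ := cauchySeq_tendsto_of_complete hc
  have hYeq : Y = (2⁻¹ : 𝕜) • (B + Y * Y) := by
    refine tendsto_nhds_unique ((tendsto_add_atTop_iff_nat 1).2 hY) ?_
    simp only [hy1]
    exact (tendsto_const_nhds.add (hY.mul hY)).const_smul (2⁻¹ : 𝕜)
  have hys : ∀ n, IsSelfAdjoint (y n) := by
    intro n
    induction n with
    | zero => rw [hy0]; exact IsSelfAdjoint.zero _
    | succ k ih =>
      rw [hy1]
      have h2 : IsSelfAdjoint (y k * y k) := by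
        have := IsSelfAdjoint.mul_star_self (y k)
        rwa [ih.star_eq] at this
      exact IsSelfAdjoint.smul (by simp [IsSelfAdjoint]) (hBs.add h2)
  refine ⟨Y, ?_, le_of_tendsto hY.norm (Eventually.of_forall fun n => (hyn n).trans (hs n).2), ?_⟩
  · refine tendsto_nhds_unique hY.star ?_
    simpa only [(hys _).star_eq] using hY
  · calc Y + Y = (2 : 𝕜) • Y := (two_smul 𝕜 Y).symm
      _ = (2 : 𝕜) • ((2⁻¹ : 𝕜) • (B + Y * Y)) := by rw [← hYeq]
      _ = B + Y * Y := by rw [smul_smul, mul_inv_cancel₀ two_ne_zero, one_smul]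

/-- A self-adjoint `A` with `‖1 - A‖ ≤ 1` has a nonnegative square root. -/
theorem exists_sqrt_of_norm_le (A : H →L[𝕜] H) (hA : IsSelfAdjoint A) (hA1 : ‖1 - A‖ ≤ 1) :
    ∃ S : H →L[𝕜] H, S.IsPositive ∧ S * S = A := by
  obtain ⟨Y, hYs, hYn, hY⟩ :=
    exists_fixedPoint 𝕜 (1 - A) ((IsSelfAdjoint.one _).sub hA) hA1
  refine ⟨1 - Y, ?_, ?_⟩
  · rw [isPositive_def']
    refine ⟨(IsSelfAdjoint.one _).sub hYs, fun x => ?_⟩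
    have h1 : RCLike.re (inner 𝕜 (Y x) x) ≤ ‖x‖ * ‖x‖ :=
      (RCLike.re_le_norm _).trans ((norm_inner_le_norm _ _).trans
        (mul_le_mul_of_nonneg_right ((Y.le_of_opNorm_le hYn x).trans (one_mul _).le)
          (norm_nonneg _)))
    have h2 : RCLike.re (inner 𝕜 x x) = ‖x‖ * ‖x‖ := inner_self_eq_norm_mul_norm x
    simp only [reApplyInnerSelf_apply, sub_apply, one_apply_eq_self, inner_sub_left, map_sub]
    linarith
  · calc (1 - Y) * (1 - Y) = 1 - (Y + Y) + Y * Y := by noncomm_ring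
      _ = 1 - (1 - A + Y * Y) + Y * Y := by rw [hY]
      _ = A := by abel

/-- Every nonnegative self-adjoint bounded operator has a nonnegative square root. -/
theorem exists_sqrt (R : H →L[𝕜] H) (hR : R.IsPositive) :
    ∃ S : H →L[𝕜] H, S.IsPositive ∧ S * S = R := by
  by_cases h0 : ‖R‖ = 0
  · have : R = 0 := norm_eq_zero.1 h0
    exact ⟨0, isPositive_zero, by simp [this]⟩
  have hr : 0 < ‖R‖ := lt_of_le_of_ne (norm_nonneg _) (Ne.symm h0)
  set r : ℝ := ‖R‖ with hrdef
  set A : H →L[𝕜] H := ((r⁻¹ : ℝ) : 𝕜) • R with hAdef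
  have hA : A.IsPositive := hR.smul_of_nonneg (by
    rw [RCLike.ofReal_nonneg]; positivity)
  have hAn : ‖A‖ ≤ 1 := by
    rw [hAdef, norm_smul, RCLike.norm_ofReal, abs_of_pos (by positivity), ← hrdef]
    exact (inv_mul_cancel₀ h0).le
  have key : ∀ x, ‖A x‖ ^ 2 ≤ RCLike.re (inner 𝕜 (A x) x) := by
    intro x
    have h1 := hA.re_inner_nonneg_left (x - A x)
    have h2 : RCLike.re (inner 𝕜 (A (A x)) (A x)) ≤ ‖A x‖ ^ 2 := by
      refine (RCLike.re_le_norm _).trans ((norm_inner_le_norm _ _).trans ?_)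
      rw [sq]
      exact mul_le_mul_of_nonneg_right ((A.le_of_opNorm_le hAn _).trans (one_mul _).le)
        (norm_nonneg _)
    have h3 : inner 𝕜 (A (A x)) x = inner 𝕜 (A x) (A x) := hA.inner_left_eq_inner_right _ _
    have h4 : RCLike.re (inner 𝕜 (A x) (A x)) = ‖A x‖ ^ 2 := by
      rw [inner_self_eq_norm_sq]
    simp only [map_sub, inner_sub_left, inner_sub_right, h3, h4] at h1
    linarith
  have hone : ‖1 - A‖ ≤ 1 := by
    refine opNorm_le_bound _ zero_le_one fun x => ?_
    rw [one_mul]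
    refine le_of_sq_le_sq ?_ (norm_nonneg _)
    have h5 : ‖(1 - A) x‖ ^ 2 = ‖x‖ ^ 2 - 2 * RCLike.re (inner 𝕜 x (A x)) + ‖A x‖ ^ 2 := by
      rw [sub_apply, one_apply_eq_self, norm_sub_sq (𝕜 := 𝕜)]
    have h6 : RCLike.re (inner 𝕜 x (A x)) = RCLike.re (inner 𝕜 (A x) x) := inner_re_symm _ _
    have := key x
    rw [h5, h6]
    nlinarith [sq_nonneg ‖A x‖]
  obtain ⟨S, hS, hSS⟩ := exists_sqrt_of_norm_le A hA.isSelfAdjoint hone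
  refine ⟨((Real.sqrt r : ℝ) : 𝕜) • S, hS.smul_of_nonneg ?_, ?_⟩
  · rw [RCLike.ofReal_nonneg]; positivity
  · rw [smul_mul_smul_comm, hSS, hAdef, smul_smul, ← RCLike.ofReal_mul, ← RCLike.ofReal_mul,
      Real.mul_self_sqrt hr.le, mul_inv_cancel₀ h0]
    simp

/-- The (unique) nonnegative square root of a nonnegative self-adjoint operator;
by convention `0` for operators that are not nonnegative self-adjoint. -/
noncomputable def opSqrt (R : H →L[𝕜] H) : H →L[𝕜] H := by
  classical
  exact if h : R.IsPositive then (exists_sqrt R h).choose else 0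

/-- The self-adjoint part `(C + C*) / 2`. -/
noncomputable def hermitianPart (C : H →L[𝕜] H) : H →L[𝕜] H :=
  (2⁻¹ : 𝕜) • (C + adjoint C)

/-- A bounded operator is accretive if `Re ⟨C x, x⟩ ≥ 0` for all `x`. -/
def IsAccretive (C : H →L[𝕜] H) : Prop :=
  ∀ x : H, 0 ≤ RCLike.re (inner 𝕜 (C x) x)

/-- The estimate `∑ j ≤ m, (C*) ^ j C_H C ^ j ≥ κ I` for some `κ > 0`, in the Loewner order. -/
def CoerciveUpTo (C : H →L[𝕜] H) (m : ℕ) : Prop :=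
  ∃ κ : ℝ, 0 < κ ∧
    (κ : 𝕜) • (1 : H →L[𝕜] H) ≤
      ∑ j ∈ Finset.range (m + 1), (adjoint C) ^ j * hermitianPart C * C ^ j

/-- `m` is the hypocoercivity index of `C`: the smallest `m` such that
`∑ j ≤ m, (C*) ^ j C_H C ^ j` is coercive. -/
def HasHypocoercivityIndex (C : H →L[𝕜] H) (m : ℕ) : Prop :=
  IsLeast {k : ℕ | CoerciveUpTo C k} m

/-- The propagator `P(t) = exp (- C t)`. -/
noncomputable def propagator (C : H →L[𝕜] H) (t : ℝ) : H →L[𝕜] H :=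
  NormedSpace.exp ((-t : 𝕜) • C)

/-- A bounded operator `C` is hypocoercive if `exp (- C t)` is a uniformly exponentially stable
semigroup. -/
def IsHypocoercive (C : H →L[𝕜] H) : Prop :=
  ∃ ε : ℝ, 0 < ε ∧ Tendsto (fun t : ℝ => Real.exp (ε * t) * ‖propagator C t‖) atTop (𝓝 0)

/-- The infimum of `‖√C_H C ^ m x‖ ^ 2` over the unit vectors `x` such that
`‖√C_H C ^ j x‖ ^ 2 ≤ δ` for all `j < m`. -/
noncomputable def constrainedInf (C : H →L[𝕜] H) (m : ℕ) (δ : ℝ) : ℝ :=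
  sInf {r : ℝ | ∃ x : H, ‖x‖ = 1 ∧
    (∀ j : ℕ, j < m → ‖opSqrt (hermitianPart C) ((C ^ j) x)‖ ^ 2 ≤ δ) ∧
    r = ‖opSqrt (hermitianPart C) ((C ^ m) x)‖ ^ 2}

end Hypocoercivity

namespace Hypocoercivity

section Legendre

open Polynomial intervalIntegral

theorem integral_eval_derivative (f : ℝ[X]) :
    ∫ s in (0 : ℝ)..1, (derivative f).eval s = f.eval 1 - f.eval 0 :=
  integral_eq_sub_of_hasDerivAt (fun x _ => f.hasDerivAt x)
    ((derivative f).continuous.intervalIntegrable _ _)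

theorem integral_eval_derivative_mul (f g : ℝ[X]) (h0 : f.eval 0 * g.eval 0 = 0)
    (h1 : f.eval 1 * g.eval 1 = 0) :
    ∫ s in (0 : ℝ)..1, (derivative f * g).eval s =
      -∫ s in (0 : ℝ)..1, (f * derivative g).eval s := by
  have h := integral_eval_derivative (f * g)
  simp only [derivative_mul, eval_add] at h
  rw [integral_add ((derivative f * g).continuous.intervalIntegrable _ _)
    ((f * derivative g).continuous.intervalIntegrable _ _), eval_mul, eval_mul, h0, h1] at h
  linarith

theorem integral_eval_iterate_derivative_mul (n : ℕ) : ∀ w g : ℝ[X],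
    (∀ i < n, (derivative^[i] w).eval 0 = 0 ∧ (derivative^[i] w).eval 1 = 0) →
    ∫ s in (0 : ℝ)..1, (derivative^[n] w * g).eval s =
      (-1) ^ n * ∫ s in (0 : ℝ)..1, (w * derivative^[n] g).eval s := by
  induction n with
  | zero => simp
  | succ n ih =>
    intro w g hw
    have h0 := hw 0 n.succ_pos
    simp only [Function.iterate_zero, id] at h0
    rw [Function.iterate_succ_apply, ih (derivative w) g fun i hi => ?_,
      integral_eval_derivative_mul, ← Function.iterate_succ_apply' derivative]
    · ring
    · simp [h0.1]
    · simp [h0.2]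
    · simpa using hw (i + 1) (by omega)

theorem integral_pow_mul_one_sub_pow (b : ℕ) : ∀ a : ℕ,
    ∫ s in (0 : ℝ)..1, ((X : ℝ[X]) ^ a * (1 - X) ^ b).eval s =
      (a.factorial * b.factorial : ℝ) / (a + b + 1).factorial := by
  induction b with
  | zero =>
    intro a
    have : (a.factorial : ℝ) ≠ 0 := by positivity
    simp only [pow_zero, mul_one, eval_pow, eval_X, integral_pow, add_zero, Nat.factorial_succ]
    push_cast
    field_simp
    simp
  | succ b ih =>
    intro a
    have h := integral_eval_derivative_mul (X ^ (a + 1)) ((1 - X) ^ (b + 1)) (by simp) (by simp)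
    have e1 : derivative ((X : ℝ[X]) ^ (a + 1)) * (1 - X) ^ (b + 1) =
        C (a + 1 : ℝ) * (X ^ a * (1 - X) ^ (b + 1)) := by
      simp; ring
    have e2 : (X : ℝ[X]) ^ (a + 1) * derivative ((1 - X) ^ (b + 1)) =
        C (-(b + 1) : ℝ) * (X ^ (a + 1) * (1 - X) ^ b) := by
      simp [derivative_pow]; ring
    rw [e1, e2] at h
    simp only [eval_C_mul (R := ℝ)] at h
    rw [integral_const_mul, integral_const_mul, ih (a + 1)] at h
    have ha : (a + 1 : ℝ) ≠ 0 := by positivity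
    apply mul_left_cancel₀ ha
    rw [h, show a + 1 + b + 1 = a + (b + 1) + 1 by ring]
    rw [Nat.factorial_succ a, Nat.factorial_succ b]
    push_cast
    ring

/-- Rescaled shifted Legendre polynomials: monic polynomials orthogonal to lower degrees. -/
theorem exists_monic_orthogonal (m : ℕ) : ∃ p : ℝ[X], p.coeff m = 1 ∧ p.natDegree ≤ m ∧
    (∀ j < m, ∫ s in (0 : ℝ)..1, p.eval s * s ^ j = 0) ∧
    ∫ s in (0 : ℝ)..1, p.eval s * s ^ m =
      (m.factorial : ℝ) ^ 2 / ((2 * m + 1).factorial * (2 * m).choose m) := by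
  set q : ℝ[X] := (shiftedLegendre m).map (Int.castRingHom ℝ) with hq
  set w : ℝ[X] := X ^ m * (1 - X) ^ m with hw
  have hch : ((2 * m).choose m : ℝ) ≠ 0 := by
    exact_mod_cast (Nat.choose_pos (by omega)).ne'
  have hf : (m.factorial : ℝ) ≠ 0 := by positivity
  have hqw : C (m.factorial : ℝ) * q = derivative^[m] w := by
    have := congrArg (Polynomial.map (Int.castRingHom ℝ)) (factorial_mul_shiftedLegendre_eq m)
    rw [← iterate_derivative_map] at this
    simpa [hq, hw] using this
  have hb : ∀ i < m, (derivative^[i] w).eval 0 = 0 ∧ (derivative^[i] w).eval 1 = 0 := by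
    intro i hi
    have h0 : (X : ℝ[X]) ^ (m - i) ∣ derivative^[i] w :=
      pow_sub_dvd_iterate_derivative_of_pow_dvd i (Dvd.intro _ rfl)
    have h1 : (1 - X : ℝ[X]) ^ (m - i) ∣ derivative^[i] w :=
      pow_sub_dvd_iterate_derivative_of_pow_dvd i (Dvd.intro_left _ rfl)
    have hne : m - i ≠ 0 := by omega
    constructor
    · obtain ⟨r, hr⟩ := h0
      simp [hr, hne]
    · obtain ⟨r, hr⟩ := h1
      simp [hr, hne]
  have key : ∀ j, (m.factorial : ℝ) * ∫ s in (0 : ℝ)..1, q.eval s * s ^ j =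
      (-1) ^ m * ∫ s in (0 : ℝ)..1, (w * derivative^[m] (X ^ j)).eval s := by
    intro j
    rw [← integral_eval_iterate_derivative_mul m w (X ^ j) hb, ← hqw, ← integral_const_mul]
    simp [mul_assoc]
  have hsign : ((-1 : ℝ) ^ m) * (-1) ^ m = 1 := by rw [← mul_pow]; simp
  refine ⟨C ((-1) ^ m / ((2 * m).choose m : ℝ)) * q, ?_, ?_, ?_, ?_⟩
  · simp only [coeff_C_mul, hq, coeff_map, coeff_shiftedLegendre, Nat.choose_self]
    push_cast
    rw [← two_mul]
    field_simp
    simp only [map_mul, map_pow, map_neg, map_one, map_natCast]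
    linear_combination ((2 * m).choose m : ℝ) * hsign
  · refine (natDegree_C_mul_le _ _).trans (natDegree_map_le.trans (natDegree_shiftedLegendre m).le)
  · intro j hj
    have h := key j
    rw [iterate_derivative_X_pow_eq_smul, Nat.descFactorial_of_lt hj] at h
    simp only [Nat.cast_zero, zero_smul, mul_zero, eval_zero, integral_zero] at h
    have h' := (mul_eq_zero.1 h).resolve_left hf
    simp only [eval_C_mul, mul_assoc, integral_const_mul, h', mul_zero]
  · have h := key m
    rw [iterate_derivative_X_pow_eq_smul, Nat.descFactorial_self, Nat.sub_self, pow_zero] at h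
    have e : ∀ s : ℝ, (w * ((m.factorial : ℝ) • (1 : ℝ[X]))).eval s =
        m.factorial * w.eval s := by
      intro s; simp [mul_comm]
    simp only [e, integral_const_mul] at h
    rw [hw, integral_pow_mul_one_sub_pow, mul_left_comm] at h
    have h' := mul_left_cancel₀ hf h
    simp only [eval_C_mul, mul_assoc, integral_const_mul, h']
    rw [← two_mul]
    field_simp
    linear_combination hsign

section CoefficientBounds

variable {E : Type*} [NormedAddCommGroup E] [InnerProductSpace ℝ E]

theorem orthogonal_integral_inner (m : ℕ) (p : ℝ[X])
    (h0 : ∀ j < m, ∫ s in (0 : ℝ)..1, p.eval s * s ^ j = 0) (v : ℕ → E) (w : E) :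
    ∫ s in (0 : ℝ)..1, p.eval s * inner ℝ (∑ j ∈ Finset.range (m + 1), s ^ j • v j) w =
      inner ℝ (v m) w * ∫ s in (0 : ℝ)..1, p.eval s * s ^ m := by
  have e : ∀ s : ℝ, p.eval s * inner ℝ (∑ j ∈ Finset.range (m + 1), s ^ j • v j) w =
      ∑ j ∈ Finset.range (m + 1), inner ℝ (v j) w * (p.eval s * s ^ j) := by
    intro s
    rw [sum_inner, Finset.mul_sum]
    refine Finset.sum_congr rfl fun j _ => ?_
    rw [real_inner_smul_left]
    ring
  simp only [e]
  rw [integral_finsetSum fun j _ => Continuous.intervalIntegrable (by fun_prop) _ _]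
  simp only [integral_const_mul]
  rw [Finset.sum_range_succ, Finset.sum_eq_zero, zero_add]
  intro j hj
  rw [h0 j (Finset.mem_range.1 hj), mul_zero]

theorem integral_sq_eq_of_orthogonal (m : ℕ) (p : ℝ[X]) (h1 : p.coeff m = 1)
    (hd : p.natDegree ≤ m) (h0 : ∀ j < m, ∫ s in (0 : ℝ)..1, p.eval s * s ^ j = 0) :
    ∫ s in (0 : ℝ)..1, p.eval s ^ 2 = ∫ s in (0 : ℝ)..1, p.eval s * s ^ m := by
  have h := orthogonal_integral_inner m p h0 (fun j => p.coeff j) 1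
  have e : ∀ s : ℝ, ∑ j ∈ Finset.range (m + 1), s ^ j • p.coeff j = p.eval s := by
    intro s
    rw [eval_eq_sum_range' (Nat.lt_succ_of_le hd)]
    exact Finset.sum_congr rfl fun j _ => by rw [smul_eq_mul, mul_comm]
  simp only [e, h1] at h
  simpa [sq] using h

/-- The mean-square norm of a perturbed polynomial controls its leading coefficient. -/
theorem leading_coeff_sq_le (E : Type*) [NormedAddCommGroup E] [InnerProductSpace ℝ E] (m : ℕ) :
    ∃ M : ℝ, 0 ≤ M ∧ ∀ (f : ℝ → E) (v : ℕ → E) (ε : ℝ), Continuous f →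
      (∀ s ∈ Set.Icc (0 : ℝ) 1, ‖f s - ∑ j ∈ Finset.range (m + 1), s ^ j • v j‖ ≤ ε) →
      (m.factorial : ℝ) ^ 2 / ((2 * m + 1).factorial * (2 * m).choose m) * ‖v m‖ ^ 2 ≤
        (∫ s in (0 : ℝ)..1, ‖f s‖ ^ 2) + M * ε * ‖v m‖ := by
  obtain ⟨p, h1, hd, h0, hm⟩ := exists_monic_orthogonal m
  set μ : ℝ := (m.factorial : ℝ) ^ 2 / ((2 * m + 1).factorial * (2 * m).choose m) with hμ
  have hp : Continuous fun s : ℝ => p.eval s := p.continuous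
  obtain ⟨B, hB⟩ := isCompact_Icc.exists_bound_of_continuousOn
    (hp.continuousOn (s := Set.Icc (0 : ℝ) 1))
  have hB0 : 0 ≤ B := (norm_nonneg _).trans (hB 0 (by simp))
  refine ⟨2 * B, by positivity, fun f v ε hf hε => ?_⟩
  set w := v m with hw
  set g : ℝ → E := fun s => ∑ j ∈ Finset.range (m + 1), s ^ j • v j with hg
  have hgc : Continuous g := by fun_prop
  have hpg : ∫ s in (0 : ℝ)..1, p.eval s * inner ℝ (g s) w = μ * ‖w‖ ^ 2 := by
    rw [orthogonal_integral_inner m p h0 v w, hm, real_inner_self_eq_norm_sq, mul_comm]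
  have hpp : ∫ s in (0 : ℝ)..1, p.eval s ^ 2 = μ := by
    rw [integral_sq_eq_of_orthogonal m p h1 hd h0, hm]
  have hmono : ∫ s in (0 : ℝ)..1, (2 * (p.eval s * inner ℝ (g s) w) - p.eval s ^ 2 * ‖w‖ ^ 2
      - 2 * B * ε * ‖w‖) ≤ ∫ s in (0 : ℝ)..1, ‖f s‖ ^ 2 := by
    refine integral_mono_on zero_le_one (Continuous.intervalIntegrable (by fun_prop) _ _)
      (Continuous.intervalIntegrable (by fun_prop) _ _) fun s hs => ?_
    have h2 : 0 ≤ ‖f s - p.eval s • w‖ ^ 2 := by positivity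
    rw [norm_sub_sq_real, real_inner_smul_right, norm_smul, mul_pow, Real.norm_eq_abs, sq_abs]
      at h2
    have h3 : |p.eval s * inner ℝ (f s - g s) w| ≤ B * (ε * ‖w‖) := by
      rw [abs_mul]
      refine mul_le_mul (hB s hs) ?_ (abs_nonneg _) hB0
      exact (abs_real_inner_le_norm _ _).trans
        (mul_le_mul_of_nonneg_right (hε s hs) (norm_nonneg _))
    have h4 := (abs_le.1 h3).1
    rw [inner_sub_left] at h4
    linarith
  rw [integral_sub (Continuous.intervalIntegrable (by fun_prop) _ _)
    (Continuous.intervalIntegrable (by fun_prop) _ _),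
    integral_sub (Continuous.intervalIntegrable (by fun_prop) _ _)
    (Continuous.intervalIntegrable (by fun_prop) _ _), integral_const_mul, integral_mul_const,
    hpg, hpp] at hmono
  simp only [integral_const, sub_zero, one_smul] at hmono
  linarith

/-- The mean-square norm of a polynomial controls all its coefficients. -/
theorem coeff_sq_le (E : Type*) [NormedAddCommGroup E] [InnerProductSpace ℝ E] (d : ℕ) :
    ∃ K : ℝ, 0 < K ∧ ∀ v : ℕ → E, ∀ j ≤ d, ‖v j‖ ^ 2 ≤
      K * ∫ s in (0 : ℝ)..1, ‖∑ j ∈ Finset.range (d + 1), s ^ j • v j‖ ^ 2 := by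
  induction d with
  | zero =>
    refine ⟨1, one_pos, fun v j hj => ?_⟩
    obtain rfl : j = 0 := by omega
    simp
  | succ d ih =>
    obtain ⟨K, hK, ih⟩ := ih
    obtain ⟨M, -, hM⟩ := leading_coeff_sq_le E (d + 1)
    set μ : ℝ := ((d + 1).factorial : ℝ) ^ 2 /
      ((2 * (d + 1) + 1).factorial * (2 * (d + 1)).choose (d + 1)) with hμ
    have hμ0 : 0 < μ := by
      have : 0 < (2 * (d + 1)).choose (d + 1) := Nat.choose_pos (by omega)
      positivity
    refine ⟨μ⁻¹ + K * (2 + 2 * μ⁻¹), by positivity, fun v j hj => ?_⟩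
    set Q := ∫ s in (0 : ℝ)..1, ‖∑ j ∈ Finset.range (d + 1 + 1), s ^ j • v j‖ ^ 2 with hQ
    have hQ0 : 0 ≤ Q := integral_nonneg zero_le_one fun s _ => by positivity
    have htop : ‖v (d + 1)‖ ^ 2 ≤ μ⁻¹ * Q := by
      have h := hM (fun s => ∑ j ∈ Finset.range (d + 1 + 1), s ^ j • v j) v 0 (by fun_prop)
        (fun s _ => by simp)
      rw [mul_zero, zero_mul, add_zero] at h
      rw [inv_mul_eq_div, le_div_iff₀ hμ0, mul_comm]
      exact h
    rcases Nat.lt_or_ge d j with hdj | hdj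
    · obtain rfl : j = d + 1 := by omega
      refine htop.trans (mul_le_mul_of_nonneg_right ?_ hQ0)
      have : 0 < K * (2 + 2 * μ⁻¹) := by positivity
      linarith
    · refine (ih v j hdj).trans ?_
      have h : ∫ s in (0 : ℝ)..1, ‖∑ j ∈ Finset.range (d + 1), s ^ j • v j‖ ^ 2 ≤
          ∫ s in (0 : ℝ)..1, (2 * ‖∑ j ∈ Finset.range (d + 1 + 1), s ^ j • v j‖ ^ 2 +
            2 * ‖v (d + 1)‖ ^ 2) := by
        refine integral_mono_on zero_le_one (Continuous.intervalIntegrable (by fun_prop) _ _)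
          (Continuous.intervalIntegrable (by fun_prop) _ _) fun s hs => ?_
        rw [Finset.sum_range_succ _ (d + 1)]
        set a := ∑ j ∈ Finset.range (d + 1), s ^ j • v j
        have h1 : ‖s ^ (d + 1) • v (d + 1)‖ ≤ ‖v (d + 1)‖ := by
          rw [norm_smul, Real.norm_eq_abs, abs_of_nonneg (pow_nonneg hs.1 _)]
          exact mul_le_of_le_one_left (norm_nonneg _) (pow_le_one₀ hs.1 hs.2)
        have h2 : ‖a‖ ≤ ‖a + s ^ (d + 1) • v (d + 1)‖ + ‖v (d + 1)‖ := by
          have := norm_sub_le (a + s ^ (d + 1) • v (d + 1)) (s ^ (d + 1) • v (d + 1))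
          rw [add_sub_cancel_right] at this
          linarith
        nlinarith [norm_nonneg a, norm_nonneg (v (d + 1)),
          norm_nonneg (a + s ^ (d + 1) • v (d + 1)),
          sq_nonneg (‖a + s ^ (d + 1) • v (d + 1)‖ - ‖v (d + 1)‖)]
      rw [integral_add (Continuous.intervalIntegrable (by fun_prop) _ _)
        (Continuous.intervalIntegrable (by fun_prop) _ _), integral_const_mul, ← hQ] at h
      simp only [integral_const, sub_zero, one_smul] at h
      have h3 : 0 ≤ μ⁻¹ * Q := by positivity
      have h4 : (∫ s in (0 : ℝ)..1, ‖∑ j ∈ Finset.range (d + 1), s ^ j • v j‖ ^ 2) ≤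
        2 * Q + 2 * (μ⁻¹ * Q) := by linarith
      have h5 := mul_le_mul_of_nonneg_left h4 hK.le
      linarith

/-- The mean-square norm of a perturbed polynomial controls all its coefficients. -/
theorem coeff_sq_le_of_approx (E : Type*) [NormedAddCommGroup E] [InnerProductSpace ℝ E] (d : ℕ) :
    ∃ K : ℝ, 0 < K ∧ ∀ (f : ℝ → E) (v : ℕ → E) (ε : ℝ), Continuous f →
      (∀ s ∈ Set.Icc (0 : ℝ) 1, ‖f s - ∑ j ∈ Finset.range (d + 1), s ^ j • v j‖ ≤ ε) →
      ∀ j ≤ d, ‖v j‖ ^ 2 ≤ K * ((∫ s in (0 : ℝ)..1, ‖f s‖ ^ 2) + ε ^ 2) := by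
  obtain ⟨K, hK, h⟩ := coeff_sq_le E d
  refine ⟨2 * K, by positivity, fun f v ε hf hε j hj => (h v j hj).trans ?_⟩
  have h : ∫ s in (0 : ℝ)..1, ‖∑ j ∈ Finset.range (d + 1), s ^ j • v j‖ ^ 2 ≤
      ∫ s in (0 : ℝ)..1, (2 * ‖f s‖ ^ 2 + 2 * ε ^ 2) := by
    refine integral_mono_on zero_le_one (Continuous.intervalIntegrable (by fun_prop) _ _)
      (Continuous.intervalIntegrable (by fun_prop) _ _) fun s hs => ?_
    set a := ∑ j ∈ Finset.range (d + 1), s ^ j • v j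
    have h1 := hε s hs
    have h2 : ‖a‖ ≤ ‖f s‖ + ε := by
      have := norm_sub_le (f s) (f s - a)
      rw [sub_sub_cancel] at this
      linarith
    nlinarith [norm_nonneg a, norm_nonneg (f s), sq_nonneg (‖f s‖ - ε)]
  rw [integral_add (Continuous.intervalIntegrable (by fun_prop) _ _)
    (Continuous.intervalIntegrable (by fun_prop) _ _), integral_const_mul] at h
  simp only [integral_const, sub_zero, one_smul] at h
  have h5 := mul_le_mul_of_nonneg_left h hK.le
  linarith

end CoefficientBounds

end Legendre

section Propagator

variable {𝕜 H : Type*} [RCLike 𝕜] [NormedAddCommGroup H] [InnerProductSpace 𝕜 H] [CompleteSpace H]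

theorem isSelfAdjoint_hermitianPart (C : H →L[𝕜] H) : IsSelfAdjoint (hermitianPart C) := by
  refine IsSelfAdjoint.smul (by simp [IsSelfAdjoint]) ?_
  rw [← star_eq_adjoint]
  exact IsSelfAdjoint.add_star_self C

theorem re_inner_hermitianPart (C : H →L[𝕜] H) (x : H) :
    RCLike.re (inner 𝕜 (hermitianPart C x) x) = RCLike.re (inner 𝕜 (C x) x) := by
  have h : RCLike.re (inner 𝕜 x (C x)) = RCLike.re (inner 𝕜 (C x) x) := inner_re_symm _ _
  have e : (2⁻¹ : 𝕜) = ((2⁻¹ : ℝ) : 𝕜) := by rw [RCLike.ofReal_inv, RCLike.ofReal_ofNat]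
  rw [hermitianPart, smul_apply, add_apply, inner_smul_left, inner_add_left, adjoint_inner_left, e,
    RCLike.conj_ofReal, RCLike.re_ofReal_mul, map_add, h]
  ring

theorem IsAccretive.isPositive_hermitianPart {C : H →L[𝕜] H} (hC : IsAccretive C) :
    (hermitianPart C).IsPositive := by
  rw [isPositive_def']
  refine ⟨isSelfAdjoint_hermitianPart C, fun x => ?_⟩
  rw [reApplyInnerSelf_apply, re_inner_hermitianPart]
  exact hC x

theorem opSqrt_spec {R : H →L[𝕜] H} (hR : R.IsPositive) :
    (opSqrt R).IsPositive ∧ opSqrt R * opSqrt R = R := by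
  rw [opSqrt, dif_pos hR]
  exact (exists_sqrt R hR).choose_spec

theorem IsAccretive.norm_sqrt_sq {C : H →L[𝕜] H} (hC : IsAccretive C) (x : H) :
    ‖opSqrt (hermitianPart C) x‖ ^ 2 = RCLike.re (inner 𝕜 (C x) x) := by
  obtain ⟨h1, h2⟩ := opSqrt_spec hC.isPositive_hermitianPart
  rw [← re_inner_hermitianPart, ← inner_self_eq_norm_sq (𝕜 := 𝕜), h1.inner_left_eq_inner_right,
    inner_re_symm, ← mul_apply_eq_comp, h2]

theorem IsAccretive.coerciveUpTo_iff {C : H →L[𝕜] H} (hC : IsAccretive C) (m : ℕ) :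
    CoerciveUpTo C m ↔ ∃ κ : ℝ, 0 < κ ∧ ∀ x : H, κ * ‖x‖ ^ 2 ≤
      ∑ j ∈ Finset.range (m + 1), ‖opSqrt (hermitianPart C) ((C ^ j) x)‖ ^ 2 := by
  refine exists_congr fun κ => and_congr_right fun _ => ?_
  have hre : ∀ x : H, RCLike.re (inner 𝕜 ((∑ j ∈ Finset.range (m + 1),
      (adjoint C) ^ j * hermitianPart C * C ^ j - (κ : 𝕜) • (1 : H →L[𝕜] H)) x) x) =
      ∑ j ∈ Finset.range (m + 1), ‖opSqrt (hermitianPart C) ((C ^ j) x)‖ ^ 2 - κ * ‖x‖ ^ 2 := by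
    intro x
    rw [sub_apply, inner_sub_left, map_sub, sum_apply, sum_inner, map_sum]
    congr 1
    · refine Finset.sum_congr rfl fun j _ => ?_
      rw [hC.norm_sqrt_sq, ← re_inner_hermitianPart C, ← star_eq_adjoint, ← star_pow,
        star_eq_adjoint, mul_apply_eq_comp, mul_apply_eq_comp, adjoint_inner_left]
    · rw [smul_apply, one_apply_eq_self, inner_smul_left, RCLike.conj_ofReal,
        RCLike.re_ofReal_mul, inner_self_eq_norm_sq]
  have hsa : IsSelfAdjoint (∑ j ∈ Finset.range (m + 1),
      (adjoint C) ^ j * hermitianPart C * C ^ j - (κ : 𝕜) • (1 : H →L[𝕜] H)) := by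
    refine IsSelfAdjoint.sub (isSelfAdjoint_sum _ fun j _ => ?_)
      (IsSelfAdjoint.smul (by simp [IsSelfAdjoint]) (IsSelfAdjoint.one _))
    rw [← star_eq_adjoint, ← star_pow]
    exact (isSelfAdjoint_hermitianPart C).conjugate' (C ^ j)
  rw [ContinuousLinearMap.le_def, isPositive_def']
  constructor
  · intro h x
    have := h.2 x
    rw [reApplyInnerSelf_apply, hre] at this
    linarith
  · refine fun h => ⟨hsa, fun x => ?_⟩
    rw [reApplyInnerSelf_apply, hre]
    linarith [h x]

theorem propagator_zero {𝕜 H : Type*} [RCLike 𝕜] [NormedAddCommGroup H] [InnerProductSpace 𝕜 H]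
    (C : H →L[𝕜] H) : propagator C 0 = 1 := by
  simp [propagator]

theorem propagator_add (C : H →L[𝕜] H) (s t : ℝ) :
    propagator C (s + t) = propagator C s * propagator C t := by
  let : NormedAlgebra ℚ (H →L[𝕜] H) := NormedAlgebra.restrictScalars ℚ 𝕜 _
  rw [propagator, propagator, propagator, ← NormedSpace.exp_add_of_commute, ← add_smul]
  · push_cast
    rw [neg_add]
  · exact ((Commute.refl C).smul_left _).smul_right _

theorem propagator_taylor (C : H →L[𝕜] H) (m : ℕ) : ∃ K r : ℝ, 0 ≤ K ∧ 0 < r ∧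
    ∀ t : ℝ, 0 ≤ t → t ≤ r →
      ‖propagator C t - ∑ j ∈ Finset.range (m + 1),
        (((-t) ^ j / j.factorial : ℝ) : 𝕜) • C ^ j‖ ≤ K * t ^ (m + 1) := by
  have hO := (NormedSpace.exp_hasFPowerSeriesAt_zero (𝕂 := 𝕜)
    (𝔸 := H →L[𝕜] H)).isBigO_sub_partialSum_pow (m + 1)
  obtain ⟨K, hK, hO⟩ := hO.exists_pos
  obtain ⟨ρ, hρ, hb⟩ := Metric.eventually_nhds_iff.1 hO.bound
  refine ⟨K * ‖C‖ ^ (m + 1), ρ / (2 * (‖C‖ + 1)), by positivity, by positivity, fun t h0 ht => ?_⟩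
  have hn : ‖(-t : 𝕜) • C‖ = t * ‖C‖ := by
    rw [norm_smul, norm_neg, RCLike.norm_ofReal, abs_of_nonneg h0]
  have h := hb (y := (-t : 𝕜) • C) (by
    rw [dist_zero_right, hn]
    rw [le_div_iff₀ (by positivity)] at ht
    nlinarith [norm_nonneg C])
  rw [zero_add, norm_pow, norm_norm, hn, mul_pow] at h
  refine le_trans (le_of_eq ?_) (h.trans (le_of_eq (by ring)))
  rw [propagator, FormalMultilinearSeries.partialSum]
  congr 2
  refine Finset.sum_congr rfl fun j _ => ?_
  rw [NormedSpace.expSeries_apply_eq, smul_pow, smul_smul]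
  congr 1
  push_cast
  ring

theorem IsAccretive.hasDerivAt_norm_sq {C : H →L[𝕜] H} (hC : IsAccretive C) (x : H) (t : ℝ) :
    HasDerivAt (fun s : ℝ => ‖propagator C s x‖ ^ 2)
      (-2 * ‖opSqrt (hermitianPart C) (propagator C t x)‖ ^ 2) t := by
  let : InnerProductSpace ℝ H := InnerProductSpace.rclikeToReal 𝕜 H
  have h1 : HasDerivAt (fun u : 𝕜 => NormedSpace.exp (u • (-C)))
      (-C * NormedSpace.exp ((t : 𝕜) • (-C))) (t : 𝕜) := hasDerivAt_exp_smul_const' (-C) (t : 𝕜)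
  have h2 : HasDerivAt (fun u : 𝕜 => NormedSpace.exp (u • (-C)) x)
      ((-C * NormedSpace.exp ((t : 𝕜) • (-C))) x) (t : 𝕜) :=
    (ContinuousLinearMap.apply 𝕜 H x).hasFDerivAt.comp_hasDerivAt (t : 𝕜) h1
  have h3 : HasDerivAt (fun s : ℝ => propagator C s x) (-C (propagator C t x)) t := by
    have h4 : HasDerivAt (fun s : ℝ => (s : 𝕜)) 1 t := by
      simpa using (RCLike.ofRealCLM (K := 𝕜)).hasDerivAt (x := t)
    have h5 := h2.scomp t h4
    simpa [propagator, Function.comp_def] using h5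
  have h6 := h3.norm_sq
  refine h6.congr_deriv ?_
  rw [hC.norm_sqrt_sq, inner_neg_right, real_inner_comm]
  change 2 * -(RCLike.re (inner 𝕜 (C (propagator C t x)) (propagator C t x))) = _
  ring

theorem continuous_propagator (C : H →L[𝕜] H) : Continuous (propagator C) := by
  let : NormedAlgebra ℚ (H →L[𝕜] H) := NormedAlgebra.restrictScalars ℚ 𝕜 _
  refine NormedSpace.exp_continuous.comp ?_
  exact (RCLike.continuous_ofReal (K := 𝕜)).neg.smul continuous_const

/-- The energy identity, on the rescaled unit time interval. -/
theorem IsAccretive.norm_propagator_sq {C : H →L[𝕜] H} (hC : IsAccretive C) (x : H) (t : ℝ) :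
    ‖propagator C t x‖ ^ 2 = ‖x‖ ^ 2 - 2 * t *
      ∫ s in (0 : ℝ)..1, ‖opSqrt (hermitianPart C) (propagator C (t * s) x)‖ ^ 2 := by
  have hc := continuous_propagator C
  have h := intervalIntegral.integral_eq_sub_of_hasDerivAt (a := 0) (b := 1)
    (f := fun s : ℝ => ‖propagator C (t * s) x‖ ^ 2)
    (f' := fun s : ℝ => (-2 * ‖opSqrt (hermitianPart C) (propagator C (t * s) x)‖ ^ 2) * t)
    (fun s _ => by
      have h1 : HasDerivAt (fun s : ℝ => t * s) t s := by simpa using (hasDerivAt_id s).const_mul t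
      exact (hC.hasDerivAt_norm_sq x (t * s)).comp s h1)
    (Continuous.intervalIntegrable (by fun_prop) _ _)
  rw [intervalIntegral.integral_mul_const, intervalIntegral.integral_const_mul] at h
  simp only [mul_one, mul_zero, propagator_zero, one_apply_eq_self] at h
  linarith

theorem IsAccretive.norm_propagator_le_one {C : H →L[𝕜] H} (hC : IsAccretive C) {t : ℝ}
    (ht : 0 ≤ t) : ‖propagator C t‖ ≤ 1 := by
  refine opNorm_le_bound _ zero_le_one fun x => ?_
  rw [one_mul]
  refine le_of_sq_le_sq ?_ (norm_nonneg _)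
  rw [hC.norm_propagator_sq]
  have : 0 ≤ ∫ s in (0 : ℝ)..1, ‖opSqrt (hermitianPart C) (propagator C (t * s) x)‖ ^ 2 :=
    intervalIntegral.integral_nonneg zero_le_one fun s _ => by positivity
  have := mul_nonneg ht this
  linarith

/-- A contraction at one positive time gives uniform exponential stability. -/
theorem IsAccretive.isHypocoercive {C : H →L[𝕜] H} (hC : IsAccretive C) {t₀ : ℝ} (ht₀ : 0 < t₀)
    (h : ‖propagator C t₀‖ < 1) : IsHypocoercive C := by
  set q : ℝ := max ‖propagator C t₀‖ 2⁻¹ with hq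
  have hq0 : 0 < q := lt_of_lt_of_le (by norm_num) (le_max_right _ _)
  have hq1 : q < 1 := max_lt h (by norm_num)
  have hlog : Real.log q < 0 := Real.log_neg hq0 hq1
  have hpow : ∀ n : ℕ, ‖propagator C (n * t₀)‖ ≤ q ^ n := by
    intro n
    induction n with
    | zero => simpa using hC.norm_propagator_le_one le_rfl
    | succ n ih =>
      push_cast
      rw [add_mul, one_mul, propagator_add, pow_succ]
      exact (norm_mul_le _ _).trans (mul_le_mul ih (le_max_left _ _) (norm_nonneg _) (by positivity))
  have hdecay : ∀ t : ℝ, 0 ≤ t → ‖propagator C t‖ ≤ q⁻¹ * Real.exp (Real.log q / t₀ * t) := by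
    intro t ht
    set n := ⌊t / t₀⌋₊ with hn
    have h1 : n * t₀ ≤ t := by
      have := Nat.floor_le (div_nonneg ht ht₀.le)
      rwa [le_div_iff₀ ht₀] at this
    have h2 : t / t₀ ≤ n + 1 := (Nat.lt_floor_add_one _).le
    have e : propagator C t = propagator C (n * t₀) * propagator C (t - n * t₀) := by
      rw [← propagator_add]; congr 1; ring
    rw [e]
    refine (norm_mul_le _ _).trans ((mul_le_of_le_one_right (norm_nonneg _)
      (hC.norm_propagator_le_one (by linarith))).trans ((hpow n).trans ?_))
    have h3 : q ^ n = q⁻¹ * Real.exp (Real.log q * (n + 1)) := by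
      rw [mul_add, Real.exp_add, mul_one, Real.exp_log hq0, mul_comm (Real.log q),
        Real.exp_nat_mul, Real.exp_log hq0]
      field_simp
    rw [h3]
    refine mul_le_mul_of_nonneg_left (Real.exp_le_exp.2 ?_) (by positivity)
    have := mul_le_mul_of_nonpos_left h2 hlog.le
    calc Real.log q * (n + 1) ≤ Real.log q * (t / t₀) := this
      _ = _ := by ring
  refine ⟨-Real.log q / (2 * t₀), div_pos (by linarith) (by positivity), ?_⟩
  have hb : Tendsto (fun t : ℝ => q⁻¹ * Real.exp (Real.log q / (2 * t₀) * t)) atTop (𝓝 0) := by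
    have h1 : Tendsto (fun t : ℝ => Real.log q / (2 * t₀) * t) atTop atBot :=
      tendsto_id.const_mul_atTop_of_neg (div_neg_of_neg_of_pos hlog (by positivity))
    simpa using (Real.tendsto_exp_atBot.comp h1).const_mul q⁻¹
  refine squeeze_zero' (Eventually.of_forall fun t => by positivity) ?_ hb
  filter_upwards [eventually_ge_atTop 0] with t ht
  calc Real.exp (-Real.log q / (2 * t₀) * t) * ‖propagator C t‖
      ≤ Real.exp (-Real.log q / (2 * t₀) * t) * (q⁻¹ * Real.exp (Real.log q / t₀ * t)) :=
        mul_le_mul_of_nonneg_left (hdecay t ht) (by positivity)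
    _ = q⁻¹ * Real.exp (Real.log q / (2 * t₀) * t) := by
        rw [mul_left_comm, ← Real.exp_add]
        congr 2
        field_simp
        ring

/-- Taylor expansion of `√C_H exp (- C t s) x` in `t`, uniformly in `s ∈ [0, 1]`. -/
theorem sqrt_propagator_taylor (T C : H →L[𝕜] H) (m : ℕ) : ∃ K r : ℝ, 0 ≤ K ∧ 0 < r ∧
    ∀ t : ℝ, 0 ≤ t → t ≤ r → ∀ s ∈ Set.Icc (0 : ℝ) 1, ∀ x : H,
      ‖T (propagator C (t * s) x) - ∑ j ∈ Finset.range (m + 1),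
        ((s ^ j : ℝ) : 𝕜) • (((-t) ^ j / j.factorial : ℝ) : 𝕜) • T ((C ^ j) x)‖ ≤
        K * t ^ (m + 1) * ‖x‖ := by
  obtain ⟨K, r, hK, hr, h⟩ := propagator_taylor C m
  refine ⟨‖T‖ * K, r, by positivity, hr, fun t ht0 htr s hs x => ?_⟩
  have hts : t * s ≤ t := mul_le_of_le_one_right ht0 hs.2
  have hts0 : 0 ≤ t * s := mul_nonneg ht0 hs.1
  have h1 := h (t * s) hts0 (hts.trans htr)
  have e : T (propagator C (t * s) x) - ∑ j ∈ Finset.range (m + 1),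
        ((s ^ j : ℝ) : 𝕜) • (((-t) ^ j / j.factorial : ℝ) : 𝕜) • T ((C ^ j) x) =
      T ((propagator C (t * s) - ∑ j ∈ Finset.range (m + 1),
        (((-(t * s)) ^ j / j.factorial : ℝ) : 𝕜) • C ^ j) x) := by
    rw [sub_apply, map_sub, sum_apply, map_sum]
    congr 1
    refine Finset.sum_congr rfl fun j _ => ?_
    rw [smul_apply, map_smul, smul_smul, ← RCLike.ofReal_mul]
    congr 2
    rw [← neg_mul, mul_pow]
    ring
  rw [e]
  calc _ ≤ ‖T‖ * (K * (t * s) ^ (m + 1) * ‖x‖) :=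
        (T.le_opNorm _).trans (mul_le_mul_of_nonneg_left (le_of_opNorm_le _ h1 x) (norm_nonneg _))
    _ ≤ ‖T‖ * (K * t ^ (m + 1) * ‖x‖) := by gcongr
    _ = _ := by ring

end Propagator

section Asymptotics

variable {𝕜 H : Type*} [RCLike 𝕜] [NormedAddCommGroup H] [InnerProductSpace 𝕜 H] [CompleteSpace H]

theorem mean_sq_ge_leading (T C : H →L[𝕜] H) (m : ℕ) : ∃ K r : ℝ, 0 ≤ K ∧ 0 < r ∧
    ∀ t : ℝ, 0 ≤ t → t ≤ r → ∀ x : H, ‖x‖ = 1 →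
      t ^ (2 * m) * (‖T ((C ^ m) x)‖ ^ 2 / ((2 * m + 1).factorial * (2 * m).choose m)) ≤
        (∫ s in (0 : ℝ)..1, ‖T (propagator C (t * s) x)‖ ^ 2) + K * t ^ (2 * m + 1) := by
  let : InnerProductSpace ℝ H := InnerProductSpace.rclikeToReal 𝕜 H
  obtain ⟨M, hM0, hM⟩ := leading_coeff_sq_le H m
  obtain ⟨K, r, hK, hr, h⟩ := sqrt_propagator_taylor T C m
  have hc := continuous_propagator C
  refine ⟨M * K * (‖T‖ * ‖C ^ m‖), r, by positivity, hr, fun t ht0 htr x hx => ?_⟩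
  have h1 := hM (fun s => T (propagator C (t * s) x))
    (fun j => (((-t) ^ j / j.factorial : ℝ) : 𝕜) • T ((C ^ j) x)) (K * t ^ (m + 1))
    (by fun_prop) (fun s hs => by
      have := h t ht0 htr s hs x
      rwa [hx, mul_one] at this)
  have e : ‖(((-t) ^ m / m.factorial : ℝ) : 𝕜) • T ((C ^ m) x)‖ =
      t ^ m / m.factorial * ‖T ((C ^ m) x)‖ := by
    rw [norm_smul, RCLike.norm_ofReal, abs_div, abs_pow, abs_neg, abs_of_nonneg ht0, Nat.abs_cast]
  rw [e] at h1
  have hf : (m.factorial : ℝ) ≠ 0 := by positivity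
  have h2 : t ^ m / m.factorial * ‖T ((C ^ m) x)‖ ≤ t ^ m * (‖T‖ * ‖C ^ m‖) := by
    have h3 : ‖T ((C ^ m) x)‖ ≤ ‖T‖ * ‖C ^ m‖ := by
      refine (T.le_opNorm _).trans (mul_le_mul_of_nonneg_left ?_ (norm_nonneg _))
      simpa [hx] using (C ^ m).le_opNorm x
    refine mul_le_mul (div_le_self (by positivity) ?_) h3 (norm_nonneg _) (by positivity)
    exact_mod_cast Nat.one_le_iff_ne_zero.2 m.factorial_ne_zero
  have h4 := mul_le_mul_of_nonneg_left h2 (by positivity : 0 ≤ M * (K * t ^ (m + 1)))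
  calc _ = (m.factorial : ℝ) ^ 2 / ((2 * m + 1).factorial * (2 * m).choose m) *
        (t ^ m / m.factorial * ‖T ((C ^ m) x)‖) ^ 2 := by
        field_simp
        ring
    _ ≤ _ := h1.trans (add_le_add_right h4 _)
    _ = _ := by ring

theorem mean_sq_ge_coeff (T C : H →L[𝕜] H) (m : ℕ) : ∃ K r : ℝ, 0 < K ∧ 0 < r ∧
    ∀ t : ℝ, 0 ≤ t → t ≤ r → ∀ x : H, ‖x‖ = 1 → ∀ j ≤ m,
      t ^ (2 * j) * ‖T ((C ^ j) x)‖ ^ 2 ≤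
        K * ((∫ s in (0 : ℝ)..1, ‖T (propagator C (t * s) x)‖ ^ 2) + t ^ (2 * m + 2)) := by
  let : InnerProductSpace ℝ H := InnerProductSpace.rclikeToReal 𝕜 H
  obtain ⟨M, hM0, hM⟩ := coeff_sq_le_of_approx H m
  obtain ⟨K, r, hK, hr, h⟩ := sqrt_propagator_taylor T C m
  have hc := continuous_propagator C
  refine ⟨(m.factorial : ℝ) ^ 2 * (M * (1 + K ^ 2)), r, by positivity, hr,
    fun t ht0 htr x hx j hj => ?_⟩
  have h1 := hM (fun s => T (propagator C (t * s) x))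
    (fun j => (((-t) ^ j / j.factorial : ℝ) : 𝕜) • T ((C ^ j) x)) (K * t ^ (m + 1))
    (by fun_prop) (fun s hs => by
      have := h t ht0 htr s hs x
      rwa [hx, mul_one] at this) j hj
  have e : ‖(((-t) ^ j / j.factorial : ℝ) : 𝕜) • T ((C ^ j) x)‖ =
      t ^ j / j.factorial * ‖T ((C ^ j) x)‖ := by
    rw [norm_smul, RCLike.norm_ofReal, abs_div, abs_pow, abs_neg, abs_of_nonneg ht0, Nat.abs_cast]
  rw [e] at h1
  set J := ∫ s in (0 : ℝ)..1, ‖T (propagator C (t * s) x)‖ ^ 2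
  have hJ : 0 ≤ J := intervalIntegral.integral_nonneg zero_le_one fun s _ => by positivity
  have hf : (j.factorial : ℝ) ≠ 0 := by positivity
  have hjm : (j.factorial : ℝ) ^ 2 ≤ (m.factorial : ℝ) ^ 2 := by
    gcongr
  calc t ^ (2 * j) * ‖T ((C ^ j) x)‖ ^ 2
      = (j.factorial : ℝ) ^ 2 * (t ^ j / j.factorial * ‖T ((C ^ j) x)‖) ^ 2 := by
        field_simp
        ring
    _ ≤ (m.factorial : ℝ) ^ 2 * (M * (J + (K * t ^ (m + 1)) ^ 2)) :=
        mul_le_mul hjm h1 (by positivity) (by positivity)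
    _ ≤ (m.factorial : ℝ) ^ 2 * (M * ((1 + K ^ 2) * (J + t ^ (2 * m + 2)))) := by
        refine mul_le_mul_of_nonneg_left (mul_le_mul_of_nonneg_left ?_ hM0.le) (by positivity)
        have e2 : (K * t ^ (m + 1)) ^ 2 = K ^ 2 * t ^ (2 * m + 2) := by ring
        rw [e2]
        have : 0 ≤ K ^ 2 * J := by positivity
        have : 0 ≤ t ^ (2 * m + 2) := by positivity
        nlinarith
    _ = _ := by ring

theorem constrainedInf_nonneg (C : H →L[𝕜] H) (m : ℕ) (δ : ℝ) : 0 ≤ constrainedInf C m δ := by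
  refine Real.sInf_nonneg ?_
  rintro _ ⟨x, -, -, rfl⟩
  positivity

theorem constrainedInf_le (C : H →L[𝕜] H) (m : ℕ) {δ : ℝ} {x : H} (hx : ‖x‖ = 1)
    (hδ : ∀ j < m, ‖opSqrt (hermitianPart C) ((C ^ j) x)‖ ^ 2 ≤ δ) :
    constrainedInf C m δ ≤ ‖opSqrt (hermitianPart C) ((C ^ m) x)‖ ^ 2 := by
  refine csInf_le ⟨0, ?_⟩ ⟨x, hx, hδ, rfl⟩
  rintro _ ⟨x, -, -, rfl⟩
  positivity

/-- Uniform lower bound on the dissipated energy. -/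
theorem eventually_mean_sq_ge (C : H →L[𝕜] H) (m : ℕ) {L ε : ℝ} (hε : 0 < ε)
    (hL : Tendsto (constrainedInf C m) (𝓝[>] 0) (𝓝 L)) :
    ∀ᶠ t : ℝ in 𝓝[>] 0, ∀ x : H, ‖x‖ = 1 →
      t ^ (2 * m) * (L / ((2 * m + 1).factorial * (2 * m).choose m) - ε) ≤
        ∫ s in (0 : ℝ)..1, ‖opSqrt (hermitianPart C) (propagator C (t * s) x)‖ ^ 2 := by
  set T := opSqrt (hermitianPart C) with hT
  set N : ℝ := (2 * m + 1).factorial * (2 * m).choose m with hN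
  have hN0 : 0 < N := by
    have : 0 < (2 * m).choose m := Nat.choose_pos (by omega)
    positivity
  have hL0 : 0 ≤ L := ge_of_tendsto hL (Eventually.of_forall fun δ => constrainedInf_nonneg C m δ)
  obtain ⟨K₁, r₁, hK₁, hr₁, h₁⟩ := mean_sq_ge_leading T C m
  obtain ⟨K₂, r₂, hK₂, hr₂, h₂⟩ := mean_sq_ge_coeff T C m
  obtain ⟨δ, hδL, hδ⟩ : ∃ δ : ℝ, L - N * (ε / 2) < constrainedInf C m δ ∧ 0 < δ :=
    ((hL.eventually (lt_mem_nhds (by linarith [mul_pos hN0 (half_pos hε)]))).and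
      self_mem_nhdsWithin).exists
  have hsmall : ∀ a > (0 : ℝ), ∀ᶠ t : ℝ in 𝓝[>] 0, t ≤ a := fun a ha =>
    mem_of_superset (Ioc_mem_nhdsGT ha) fun t ht => ht.2
  filter_upwards [hsmall r₁ hr₁, hsmall r₂ hr₂, hsmall 1 one_pos,
    hsmall (ε / (2 * (K₁ + 1))) (by positivity), hsmall (δ / (K₂ * (L / N + 1))) (by positivity),
    self_mem_nhdsWithin] with t ht₁ ht₂ ht1 htε htδ ht0 x hx
  have ht0 : 0 < t := ht0
  set J := ∫ s in (0 : ℝ)..1, ‖T (propagator C (t * s) x)‖ ^ 2 with hJ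
  by_cases hx' : ∀ j < m, ‖T ((C ^ j) x)‖ ^ 2 ≤ δ
  · have h3 := constrainedInf_le C m hx hx'
    have h4 := h₁ t ht0.le ht₁ x hx
    have h5 : L / N - ε / 2 ≤ ‖T ((C ^ m) x)‖ ^ 2 / N := by
      rw [le_div_iff₀ hN0]
      have : (L / N - ε / 2) * N = L - N * (ε / 2) := by field_simp
      linarith
    have h6 : K₁ * t ≤ ε / 2 := by
      rw [le_div_iff₀ (by positivity)] at htε
      nlinarith
    have h7 : 0 ≤ t ^ (2 * m) := by positivity
    have h8 := mul_le_mul_of_nonneg_left h5 h7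
    have h9 := mul_le_mul_of_nonneg_left h6 h7
    rw [pow_succ t (2 * m)] at h4
    linarith
  · push Not at hx'
    obtain ⟨j, hj, hxj⟩ := hx'
    by_contra! hlt
    have h3 := h₂ t ht0.le ht₂ x hx j hj.le
    have h4 : J + t ^ (2 * m + 2) ≤ t ^ (2 * m) * (L / N + 1) := by
      have : t ^ (2 * m + 2) ≤ t ^ (2 * m) * 1 := by
        rw [pow_add]
        exact mul_le_mul_of_nonneg_left (pow_le_one₀ ht0.le ht1) (by positivity)
      have : 0 ≤ t ^ (2 * m) * ε := by positivity
      linarith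
    have h5 : t ^ (2 * m) ≤ t ^ (2 * j) * t := by
      rw [← pow_succ]
      exact pow_le_pow_of_le_one ht0.le ht1 (by omega)
    have h6 : t ^ (2 * j) * δ < t ^ (2 * j) * (t * (K₂ * (L / N + 1))) := by
      calc t ^ (2 * j) * δ < t ^ (2 * j) * ‖T ((C ^ j) x)‖ ^ 2 :=
            mul_lt_mul_of_pos_left hxj (by positivity)
        _ ≤ K₂ * (t ^ (2 * m) * (L / N + 1)) :=
            h3.trans (mul_le_mul_of_nonneg_left h4 hK₂.le)
        _ ≤ K₂ * (t ^ (2 * j) * t * (L / N + 1)) := by gcongr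
        _ = _ := by ring
    have h7 := lt_of_mul_lt_mul_left h6 (by positivity)
    rw [le_div_iff₀ (by positivity)] at htδ
    linarith

/-- Test vectors for which `√C_H exp (- C t s) y` is close to a multiple of the
monic orthogonal polynomial. -/
theorem exists_mean_sq_le (T C : H →L[𝕜] H) (m : ℕ) : ∃ K r : ℝ, 0 ≤ K ∧ 0 < r ∧
    ∀ t : ℝ, 0 < t → t ≤ r → ∀ x : H, ‖x‖ = 1 → (∀ i < m, ‖T ((C ^ i) x)‖ ≤ t ^ (m + 1)) →
      ∃ y : H, ‖y - x‖ ≤ K * t ∧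
        ∫ s in (0 : ℝ)..1, ‖T (propagator C (t * s) y)‖ ^ 2 ≤
          t ^ (2 * m) *
            (‖T ((C ^ m) x)‖ ^ 2 / ((2 * m + 1).factorial * (2 * m).choose m) + K * t) := by
  obtain ⟨p, hp1, hpd, hp0, hpm⟩ := exists_monic_orthogonal m
  obtain ⟨K₁, r, hK₁, hr, h₁⟩ := sqrt_propagator_taylor T C m
  have hp : Continuous fun s : ℝ => p.eval s := p.continuous
  have hpp := integral_sq_eq_of_orthogonal m p hp1 hpd hp0
  rw [hpm] at hpp
  obtain ⟨B, hB⟩ := isCompact_Icc.exists_bound_of_continuousOn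
    (hp.continuousOn (s := Set.Icc (0 : ℝ) 1))
  have hB0 : 0 ≤ B := (norm_nonneg _).trans (hB 0 (by simp))
  have hc := continuous_propagator C
  have hf : (m.factorial : ℝ) ≠ 0 := by positivity
  obtain ⟨b, hb⟩ : ∃ b : ℕ → ℝ, b = fun k => (-1) ^ m * (-1) ^ (m - k) * (m - k).factorial *
    p.coeff (m - k) / m.factorial := ⟨_, rfl⟩
  have hsign : ∀ j, ((-1 : ℝ) ^ j) * (-1) ^ j = 1 := fun j => by rw [← mul_pow]; simp
  have hb0 : b 0 = 1 := by
    simp only [hb, Nat.sub_zero, hp1, hsign]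
    field_simp
  obtain ⟨K₂, hK₂⟩ : ∃ K : ℝ, K = ∑ k ∈ Finset.range m, |b (k + 1)| * ‖C ^ (k + 1)‖ := ⟨_, rfl⟩
  have hK₂0 : 0 ≤ K₂ := by rw [hK₂]; positivity
  obtain ⟨K₃, hK₃⟩ : ∃ K : ℝ, K = ∑ j ∈ Finset.range (m + 1), ∑ k ∈ Finset.range (m + 1),
    |b k| * (1 + ‖T‖ * ‖C ^ (j + k)‖) := ⟨_, rfl⟩
  have hK₃0 : 0 ≤ K₃ := by rw [hK₃]; positivity
  obtain ⟨K₄, hK₄⟩ : ∃ K : ℝ, K = K₃ + K₁ * (1 + K₂) := ⟨_, rfl⟩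
  have hK₄0 : 0 ≤ K₄ := by rw [hK₄]; positivity
  obtain ⟨W, hW⟩ : ∃ W : ℝ, W = ‖T‖ * ‖C ^ m‖ := ⟨_, rfl⟩
  have hW0 : 0 ≤ W := by rw [hW]; positivity
  refine ⟨K₂ + (2 * B * W * K₄ + K₄ ^ 2), min r 1, by positivity, by positivity,
    fun t ht0 htr x hx hT => ?_⟩
  have ht1 : t ≤ 1 := htr.trans (min_le_right _ _)
  replace htr : t ≤ r := htr.trans (min_le_left _ _)
  have hTC : ∀ i, ‖T ((C ^ i) x)‖ ≤ ‖T‖ * ‖C ^ i‖ := fun i => by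
    refine (T.le_opNorm _).trans (mul_le_mul_of_nonneg_left ?_ (norm_nonneg _))
    simpa [hx] using (C ^ i).le_opNorm x
  set y : H := ∑ k ∈ Finset.range (m + 1), ((b k * t ^ k : ℝ) : 𝕜) • (C ^ k) x with hy
  have hyx : ‖y - x‖ ≤ K₂ * t := by
    rw [hy, Finset.sum_range_succ', hb0]
    simp only [pow_zero, mul_one, RCLike.ofReal_one, one_smul, one_apply_eq_self,
      add_sub_cancel_right]
    rw [hK₂, Finset.sum_mul]
    refine norm_sum_le_of_le _ fun k _ => ?_
    rw [norm_smul, RCLike.norm_ofReal, abs_mul, abs_of_nonneg (by positivity : 0 ≤ t ^ (k + 1))]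
    have h3 : ‖(C ^ (k + 1)) x‖ ≤ ‖C ^ (k + 1)‖ := by simpa [hx] using (C ^ (k + 1)).le_opNorm x
    have h4 : t ^ (k + 1) ≤ t := pow_le_of_le_one ht0.le ht1 (by omega)
    calc |b (k + 1)| * t ^ (k + 1) * ‖(C ^ (k + 1)) x‖
        ≤ |b (k + 1)| * t * ‖C ^ (k + 1)‖ := by gcongr
      _ = _ := by ring
  have hy1 : ‖y‖ ≤ 1 + K₂ := by
    have h3 : ‖y‖ ≤ ‖x‖ + ‖y - x‖ := norm_le_norm_add_norm_sub' y x
    have h4 : K₂ * t ≤ K₂ := mul_le_of_le_one_right hK₂0 ht1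
    linarith
  have hmain : ∀ s ∈ Set.Icc (0 : ℝ) 1, ‖T (propagator C (t * s) y)‖ ≤
      t ^ m * (|p.eval s| / m.factorial * ‖T ((C ^ m) x)‖ + K₄ * t) := by
    intro s hs
    set z : ℕ → ℕ → H := fun j k => ((s ^ j * ((-t) ^ j / j.factorial) * (b k * t ^ k) : ℝ) : 𝕜) •
      T ((C ^ (j + k)) x) with hz
    have hexp : ∑ j ∈ Finset.range (m + 1),
        ((s ^ j : ℝ) : 𝕜) • (((-t) ^ j / j.factorial : ℝ) : 𝕜) • T ((C ^ j) y) =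
        ∑ j ∈ Finset.range (m + 1), ∑ k ∈ Finset.range (m + 1), z j k := by
      refine Finset.sum_congr rfl fun j _ => ?_
      rw [hy, map_sum, map_sum, Finset.smul_sum, Finset.smul_sum]
      refine Finset.sum_congr rfl fun k _ => ?_
      simp only [hz]
      rw [map_smul, map_smul, smul_smul, smul_smul, ← RCLike.ofReal_mul, ← RCLike.ofReal_mul,
        ← mul_apply_eq_comp (C ^ j), ← pow_add]
    have hdiag : ∑ j ∈ Finset.range (m + 1), z j (m - j) =
        (((-1) ^ m * t ^ m * p.eval s / m.factorial : ℝ) : 𝕜) • T ((C ^ m) x) := by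
      have e : (-1) ^ m * t ^ m * p.eval s / m.factorial = ∑ j ∈ Finset.range (m + 1),
          s ^ j * ((-t) ^ j / j.factorial) * (b (m - j) * t ^ (m - j)) := by
        rw [Polynomial.eval_eq_sum_range' (Nat.lt_succ_of_le hpd), Finset.mul_sum,
          Finset.sum_div]
        refine Finset.sum_congr rfl fun j hj => ?_
        have hjm : j ≤ m := Nat.lt_succ_iff.1 (Finset.mem_range.1 hj)
        have hfj : (j.factorial : ℝ) ≠ 0 := by positivity
        simp only [hb, Nat.sub_sub_self hjm]
        rw [neg_pow t j]
        have htj : t ^ m = t ^ j * t ^ (m - j) := by rw [← pow_add]; congr 1; omega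
        rw [htj]
        field_simp
        linear_combination (-(s ^ j * p.coeff j)) * hsign j
      rw [e, RCLike.ofReal_sum, Finset.sum_smul]
      refine Finset.sum_congr rfl fun j hj => ?_
      have hjm : j ≤ m := Nat.lt_succ_iff.1 (Finset.mem_range.1 hj)
      simp only [hz, Nat.add_sub_cancel' hjm]
    have hoff : ∀ j k, j + k ≠ m →
        ‖z j k‖ ≤ |b k| * (1 + ‖T‖ * ‖C ^ (j + k)‖) * t ^ (m + 1) := by
      intro j k hjk
      have h3 : ‖z j k‖ ≤ |b k| * (t ^ (j + k) * ‖T ((C ^ (j + k)) x)‖) := by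
        simp only [hz]
        rw [norm_smul, RCLike.norm_ofReal, abs_mul, abs_mul, abs_mul, abs_div, abs_pow, abs_pow,
          abs_pow, abs_neg, Nat.abs_cast, abs_of_nonneg ht0.le, abs_of_nonneg hs.1, pow_add t j k]
        have h4 : s ^ j * (t ^ j / j.factorial) ≤ 1 * t ^ j := by
          refine mul_le_mul (pow_le_one₀ hs.1 hs.2) (div_le_self (by positivity) ?_)
            (by positivity) zero_le_one
          exact_mod_cast Nat.one_le_iff_ne_zero.2 j.factorial_ne_zero
        calc s ^ j * (t ^ j / j.factorial) * (|b k| * t ^ k) * ‖T ((C ^ (j + k)) x)‖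
            ≤ 1 * t ^ j * (|b k| * t ^ k) * ‖T ((C ^ (j + k)) x)‖ := by gcongr
          _ = _ := by ring
      refine h3.trans ?_
      rw [mul_assoc]
      refine mul_le_mul_of_nonneg_left ?_ (abs_nonneg _)
      rcases lt_or_gt_of_ne hjk with hlt | hgt
      · calc t ^ (j + k) * ‖T ((C ^ (j + k)) x)‖ ≤ 1 * t ^ (m + 1) :=
              mul_le_mul (pow_le_one₀ ht0.le ht1) (hT _ hlt) (norm_nonneg _) zero_le_one
          _ ≤ (1 + ‖T‖ * ‖C ^ (j + k)‖) * t ^ (m + 1) := by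
              refine mul_le_mul_of_nonneg_right ?_ (by positivity)
              exact le_add_of_nonneg_right (by positivity)
      · calc t ^ (j + k) * ‖T ((C ^ (j + k)) x)‖ ≤ t ^ (m + 1) * (‖T‖ * ‖C ^ (j + k)‖) :=
              mul_le_mul (pow_le_pow_of_le_one ht0.le ht1 hgt) (hTC _) (norm_nonneg _)
                (by positivity)
          _ ≤ (1 + ‖T‖ * ‖C ^ (j + k)‖) * t ^ (m + 1) := by
              rw [mul_comm]
              refine mul_le_mul_of_nonneg_right ?_ (by positivity)
              exact le_add_of_nonneg_left zero_le_one
    have hrest : ‖∑ j ∈ Finset.range (m + 1), ∑ k ∈ Finset.range (m + 1), z j k -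
        ∑ j ∈ Finset.range (m + 1), z j (m - j)‖ ≤ K₃ * t ^ (m + 1) := by
      rw [← Finset.sum_sub_distrib, hK₃, Finset.sum_mul]
      refine norm_sum_le_of_le _ fun j hj => ?_
      have hjm : j ≤ m := Nat.lt_succ_iff.1 (Finset.mem_range.1 hj)
      have hmem : m - j ∈ Finset.range (m + 1) := Finset.mem_range.2 (by omega)
      rw [← Finset.sum_erase_add _ _ hmem, add_sub_cancel_right, Finset.sum_mul]
      refine (norm_sum_le_of_le _ fun k hk => hoff j k ?_).trans
        (Finset.sum_le_sum_of_subset_of_nonneg (Finset.erase_subset _ _)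
          fun k _ _ => by positivity)
      have := Finset.ne_of_mem_erase hk
      omega
    have htay := h₁ t ht0.le htr s hs y
    rw [hexp] at htay
    rw [hdiag] at hrest
    set u := T (propagator C (t * s) y)
    set Z := ∑ j ∈ Finset.range (m + 1), ∑ k ∈ Finset.range (m + 1), z j k
    set D := (((-1) ^ m * t ^ m * p.eval s / m.factorial : ℝ) : 𝕜) • T ((C ^ m) x) with hD
    have hDn : ‖D‖ = t ^ m * (|p.eval s| / m.factorial * ‖T ((C ^ m) x)‖) := by
      rw [hD, norm_smul, RCLike.norm_ofReal, abs_div, abs_mul, abs_mul, abs_pow, abs_pow, abs_neg,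
        abs_one, one_pow, Nat.abs_cast, abs_of_nonneg ht0.le]
      ring
    have hu : ‖u‖ ≤ ‖D‖ + ‖Z - D‖ + ‖u - Z‖ := by
      have : u = D + (Z - D) + (u - Z) := by abel
      conv_lhs => rw [this]
      exact norm_add₃_le
    have h5 : K₁ * t ^ (m + 1) * ‖y‖ ≤ K₁ * t ^ (m + 1) * (1 + K₂) := by gcongr
    calc ‖u‖ ≤ t ^ m * (|p.eval s| / m.factorial * ‖T ((C ^ m) x)‖) + K₃ * t ^ (m + 1) +
          K₁ * t ^ (m + 1) * (1 + K₂) := by rw [← hDn]; linarith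
      _ = _ := by rw [hK₄, pow_succ]; ring
  refine ⟨y, hyx.trans (mul_le_mul_of_nonneg_right ?_ ht0.le), ?_⟩
  · exact le_add_of_nonneg_right (by positivity)
  have hsq : ∫ s in (0 : ℝ)..1, ‖T (propagator C (t * s) y)‖ ^ 2 ≤
      ∫ s in (0 : ℝ)..1, t ^ (2 * m) * (p.eval s ^ 2 * (‖T ((C ^ m) x)‖ ^ 2 / m.factorial ^ 2) +
        (2 * B * W * K₄ + K₄ ^ 2) * t) := by
    refine intervalIntegral.integral_mono_on zero_le_one
      (Continuous.intervalIntegrable (by fun_prop) _ _)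
      (Continuous.intervalIntegrable (by fun_prop) _ _) fun s hs => ?_
    refine (pow_le_pow_left₀ (norm_nonneg _) (hmain s hs) 2).trans ?_
    rw [mul_pow, ← pow_mul, mul_comm m 2]
    refine mul_le_mul_of_nonneg_left ?_ (by positivity)
    set A := |p.eval s| / m.factorial * ‖T ((C ^ m) x)‖ with hA
    have hA2 : A ^ 2 = p.eval s ^ 2 * (‖T ((C ^ m) x)‖ ^ 2 / m.factorial ^ 2) := by
      rw [hA, mul_pow, div_pow, sq_abs]; ring
    have hA1 : A ≤ B * W := by
      refine mul_le_mul ((div_le_self (abs_nonneg _) ?_).trans (hB s hs)) ((hTC m).trans hW.ge)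
        (norm_nonneg _) hB0
      exact_mod_cast Nat.one_le_iff_ne_zero.2 m.factorial_ne_zero
    rw [← hA2]
    have h6 := mul_le_mul_of_nonneg_right hA1 (by positivity : 0 ≤ K₄ * t)
    have h7 : K₄ ^ 2 * t ^ 2 ≤ K₄ ^ 2 * t :=
      mul_le_mul_of_nonneg_left (pow_le_of_le_one ht0.le ht1 two_ne_zero) (by positivity)
    linarith [show (A + K₄ * t) ^ 2 = A ^ 2 + 2 * (A * (K₄ * t)) + K₄ ^ 2 * t ^ 2 by ring]
  refine hsq.trans ?_
  rw [intervalIntegral.integral_const_mul, intervalIntegral.integral_add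
    (Continuous.intervalIntegrable (by fun_prop) _ _)
    (Continuous.intervalIntegrable (by fun_prop) _ _), intervalIntegral.integral_mul_const, hpp]
  simp only [intervalIntegral.integral_const, sub_zero, one_smul]
  refine mul_le_mul_of_nonneg_left (add_le_add (le_of_eq ?_) ?_) (by positivity)
  · field_simp
  · exact mul_le_mul_of_nonneg_right (le_add_of_nonneg_left hK₂0) ht0.le

end Asymptotics

section Main

variable {𝕜 H : Type*} [RCLike 𝕜] [NormedAddCommGroup H] [InnerProductSpace 𝕜 H] [CompleteSpace H]

theorem IsAccretive.exists_unit_of_not_coerciveUpTo {C : H →L[𝕜] H} (hC : IsAccretive C) {k : ℕ}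
    (hk : ¬CoerciveUpTo C k) {δ : ℝ} (hδ : 0 < δ) :
    ∃ x : H, ‖x‖ = 1 ∧ ∀ j ≤ k, ‖opSqrt (hermitianPart C) ((C ^ j) x)‖ ^ 2 ≤ δ := by
  set T := opSqrt (hermitianPart C)
  rw [hC.coerciveUpTo_iff] at hk
  push Not at hk
  obtain ⟨x, hx⟩ := hk δ hδ
  have hx0 : x ≠ 0 := by
    rintro rfl
    simp at hx
  have hn : 0 < ‖x‖ := norm_pos_iff.2 hx0
  refine ⟨((‖x‖⁻¹ : ℝ) : 𝕜) • x, ?_, fun j hj => ?_⟩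
  · rw [norm_smul, RCLike.norm_ofReal, abs_of_pos (inv_pos.2 hn), inv_mul_cancel₀ hn.ne']
  · rw [map_smul, map_smul, norm_smul, RCLike.norm_ofReal, abs_of_pos (inv_pos.2 hn), mul_pow,
      inv_pow, inv_mul_le_iff₀ (by positivity), mul_comm]
    refine le_trans ?_ hx.le
    exact Finset.single_le_sum (f := fun j => ‖T ((C ^ j) x)‖ ^ 2) (fun i _ => by positivity)
      (Finset.mem_range.2 (Nat.lt_succ_of_le hj))

theorem IsAccretive.exists_unit_of_index [Nontrivial H] {C : H →L[𝕜] H} (hC : IsAccretive C)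
    {m : ℕ} (hm : HasHypocoercivityIndex C m) {δ : ℝ} (hδ : 0 < δ) :
    ∃ x : H, ‖x‖ = 1 ∧ ∀ j < m, ‖opSqrt (hermitianPart C) ((C ^ j) x)‖ ^ 2 ≤ δ := by
  rcases m with _ | k
  · obtain ⟨x, hx⟩ := exists_ne (0 : H)
    refine ⟨((‖x‖⁻¹ : ℝ) : 𝕜) • x, ?_, fun j hj => absurd hj (Nat.not_lt_zero j)⟩
    have hn : 0 < ‖x‖ := norm_pos_iff.2 hx
    rw [norm_smul, RCLike.norm_ofReal, abs_of_pos (inv_pos.2 hn), inv_mul_cancel₀ hn.ne']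
  · obtain ⟨x, hx, h⟩ := hC.exists_unit_of_not_coerciveUpTo (k := k)
      (fun h => absurd (hm.2 h) (by omega)) hδ
    exact ⟨x, hx, fun j hj => h j (Nat.lt_succ_iff.1 hj)⟩

/-- The limit of the constrained infima exists and is positive. -/
theorem IsAccretive.exists_tendsto_constrainedInf [Nontrivial H] {C : H →L[𝕜] H}
    (hC : IsAccretive C) {m : ℕ} (hm : HasHypocoercivityIndex C m) :
    ∃ L : ℝ, 0 < L ∧ Tendsto (constrainedInf C m) (𝓝[>] 0) (𝓝 L) ∧
      ∀ δ > 0, constrainedInf C m δ ≤ L := by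
  set T := opSqrt (hermitianPart C) with hT
  have hanti : AntitoneOn (constrainedInf C m) (Set.Ioi 0) := by
    intro δ hδ δ' _ hle
    obtain ⟨x, hx, h⟩ := hC.exists_unit_of_index hm hδ
    refine csInf_le_csInf ⟨0, ?_⟩ ⟨_, x, hx, h, rfl⟩ ?_
    · rintro _ ⟨x, -, -, rfl⟩
      positivity
    · rintro _ ⟨x, hx, h, rfl⟩
      exact ⟨x, hx, fun j hj => (h j hj).trans hle, rfl⟩
  have hbdd : BddAbove (constrainedInf C m '' Set.Ioi 0) := by
    refine ⟨(‖T‖ * ‖C ^ m‖) ^ 2, ?_⟩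
    rintro _ ⟨δ, hδ, rfl⟩
    obtain ⟨x, hx, h⟩ := hC.exists_unit_of_index hm hδ
    refine (constrainedInf_le C m hx h).trans (pow_le_pow_left₀ (norm_nonneg _) ?_ 2)
    refine (T.le_opNorm _).trans (mul_le_mul_of_nonneg_left ?_ (norm_nonneg _))
    simpa [hx] using (C ^ m).le_opNorm x
  have hle : ∀ δ > 0, constrainedInf C m δ ≤ sSup (constrainedInf C m '' Set.Ioi 0) :=
    fun δ hδ => le_csSup hbdd ⟨δ, hδ, rfl⟩
  refine ⟨sSup (constrainedInf C m '' Set.Ioi 0), ?_, hanti.tendsto_nhdsGT hbdd, hle⟩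
  obtain ⟨κ, hκ, h⟩ := (hC.coerciveUpTo_iff m).1 hm.1
  have hδ : 0 < κ / (2 * (m + 1)) := by positivity
  refine lt_of_lt_of_le (half_pos hκ) (le_trans ?_ (hle _ hδ))
  obtain ⟨x, hx, hx'⟩ := hC.exists_unit_of_index hm hδ
  refine le_csInf ⟨_, x, hx, hx', rfl⟩ ?_
  rintro _ ⟨x, hx, hx', rfl⟩
  have h1 := h x
  rw [hx, one_pow, mul_one, Finset.sum_range_succ] at h1
  have h2 : ∑ j ∈ Finset.range m, ‖T ((C ^ j) x)‖ ^ 2 ≤ m * (κ / (2 * (m + 1))) := by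
    have := Finset.sum_le_card_nsmul (Finset.range m) (fun j => ‖T ((C ^ j) x)‖ ^ 2)
      (κ / (2 * (m + 1))) fun j hj => hx' j (Finset.mem_range.1 hj)
    simpa using this
  have h3 : m * (κ / (2 * (m + 1))) ≤ κ / 2 := by
    have : (m : ℝ) * (κ / (2 * (m + 1))) = κ / 2 * (m / (m + 1)) := by field_simp
    rw [this]
    refine mul_le_of_le_one_right (by positivity) ?_
    rw [div_le_one (by positivity)]
    linarith
  linarith

theorem IsAccretive.norm_propagator_sq_ge {C : H →L[𝕜] H} (hC : IsAccretive C) {t A : ℝ}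
    (ht : 0 ≤ t) {y : H} (hy : y ≠ 0)
    (h : ∫ s in (0 : ℝ)..1, ‖opSqrt (hermitianPart C) (propagator C (t * s) y)‖ ^ 2 ≤
      A * ‖y‖ ^ 2) : 1 - 2 * t * A ≤ ‖propagator C t‖ ^ 2 := by
  have hy0 : 0 < ‖y‖ ^ 2 := by
    have := norm_pos_iff.2 hy
    positivity
  have h1 := hC.norm_propagator_sq y t
  have h2 : ‖propagator C t y‖ ^ 2 ≤ (‖propagator C t‖ * ‖y‖) ^ 2 :=
    pow_le_pow_left₀ (norm_nonneg _) ((propagator C t).le_opNorm y) 2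
  have h3 := mul_le_mul_of_nonneg_left h (by positivity : 0 ≤ 2 * t)
  refine le_of_mul_le_mul_right ?_ hy0
  rw [mul_pow] at h2
  linarith

theorem eventually_nhdsGT_mul_pow_le (b : ℝ) (n : ℕ) {ε : ℝ} (hε : 0 < ε) :
    ∀ᶠ t : ℝ in 𝓝[>] 0, b * t ^ (n + 1) ≤ ε := by
  have h : Tendsto (fun t : ℝ => b * t ^ (n + 1)) (𝓝[>] 0) (𝓝 0) := by
    have : Continuous fun t : ℝ => b * t ^ (n + 1) := by fun_prop
    simpa using (this.tendsto 0).mono_left nhdsWithin_le_nhds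
  exact h.eventually (ge_mem_nhds hε)

/-- Short-time asymptotics of the propagator norm. -/
theorem IsAccretive.norm_propagator_isLittleO [Nontrivial H] {C : H →L[𝕜] H} (hC : IsAccretive C)
    {m : ℕ} {L : ℝ} (hm : HasHypocoercivityIndex C m)
    (hL : Tendsto (constrainedInf C m) (𝓝[>] 0) (𝓝 L)) (hL' : ∀ δ > 0, constrainedInf C m δ ≤ L) :
    (fun t : ℝ => ‖propagator C t‖ -
      (1 - L / ((2 * m + 1).factorial * (2 * m).choose m) * t ^ (2 * m + 1)))
      =o[𝓝[>] 0] (fun t : ℝ => t ^ (2 * m + 1)) := by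
  set T := opSqrt (hermitianPart C) with hT
  set N : ℝ := (2 * m + 1).factorial * (2 * m).choose m with hN
  have hN0 : 0 < N := by
    have : 0 < (2 * m).choose m := Nat.choose_pos (by omega)
    positivity
  set c := L / N with hc
  obtain ⟨K, r, hK, hr, hup⟩ := exists_mean_sq_le T C m
  rw [Asymptotics.isLittleO_iff]
  intro ε hε
  have hlow := eventually_mean_sq_ge C m hε hL
  have hratio : ∀ᶠ t : ℝ in 𝓝[>] 0, (c + (1 / N + K) * t) / (1 - K * t) ^ 2 < c + ε / 2 := by
    have h1 : ContinuousAt (fun t : ℝ => (c + (1 / N + K) * t) / (1 - K * t) ^ 2) 0 :=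
      ContinuousAt.div (by fun_prop) (by fun_prop) (by simp)
    have h2 : Tendsto (fun t : ℝ => (c + (1 / N + K) * t) / (1 - K * t) ^ 2) (𝓝[>] 0) (𝓝 c) := by
      simpa [ContinuousAt] using h1.tendsto.mono_left nhdsWithin_le_nhds
    exact h2.eventually (gt_mem_nhds (by linarith))
  have hKt := eventually_nhdsGT_mul_pow_le K 0 (one_half_pos (α := ℝ))
  have hrt := eventually_nhdsGT_mul_pow_le 1 0 hr
  have hu1 := eventually_nhdsGT_mul_pow_le ((c + ε) ^ 2) (2 * m) hε
  have hu2 := eventually_nhdsGT_mul_pow_le (c - ε) (2 * m) one_pos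
  filter_upwards [hlow, hratio, hKt, hrt, hu1, hu2, self_mem_nhdsWithin] with
    t hlow hratio hKt hrt hu1 hu2 ht0
  have ht0 : 0 < t := ht0
  rw [zero_add, pow_one] at hKt hrt
  rw [one_mul] at hrt
  set u := t ^ (2 * m + 1) with hu
  have hu0 : 0 < u := by positivity
  have htu : ∀ a : ℝ, 2 * t * (t ^ (2 * m) * a) = 2 * (a * u) := fun a => by
    rw [hu, pow_succ]; ring
  have hupper : ‖propagator C t‖ ≤ 1 - (c - ε) * u := by
    refine opNorm_le_of_unit_norm (by linarith) fun x hx => ?_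
    refine le_of_sq_le_sq ?_ (by linarith)
    rw [hC.norm_propagator_sq, hx]
    have h1 := mul_le_mul_of_nonneg_left (hlow x hx) (by positivity : 0 ≤ 2 * t)
    rw [htu] at h1
    nlinarith [sq_nonneg ((c - ε) * u)]
  have hlower : 1 - (c + ε) * u ≤ ‖propagator C t‖ := by
    have hδ : 0 < (t ^ (m + 1)) ^ 2 := by positivity
    obtain ⟨x₀, hx₀, hx₀'⟩ := hC.exists_unit_of_index hm hδ
    obtain ⟨_, ⟨x, hx, hx', rfl⟩, hlt⟩ := exists_lt_of_csInf_lt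
      (by exact ⟨_, x₀, hx₀, hx₀', rfl⟩) (lt_of_le_of_lt (hL' _ hδ) (lt_add_of_pos_right L ht0))
    obtain ⟨y, hyx, hJ⟩ := hup t ht0 hrt x hx fun i hi =>
      le_of_sq_le_sq (hx' i hi) (by positivity)
    have hy : 1 - K * t ≤ ‖y‖ := by
      have := norm_le_norm_add_norm_sub y x
      linarith
    have hy0 : y ≠ 0 := norm_pos_iff.1 (by linarith)
    have h1 : c + (1 / N + K) * t ≤ (c + ε / 2) * ‖y‖ ^ 2 := by
      have h2 : 0 < (1 - K * t) ^ 2 := by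
        have : 0 < 1 - K * t := by linarith
        positivity
      rw [div_lt_iff₀ h2] at hratio
      have h3 : (1 - K * t) ^ 2 ≤ ‖y‖ ^ 2 := pow_le_pow_left₀ (by linarith) hy 2
      have hc0 : 0 ≤ c := div_nonneg (ge_of_tendsto hL
        (Eventually.of_forall fun δ => constrainedInf_nonneg C m δ)) hN0.le
      have h4 := mul_le_mul_of_nonneg_left h3 (by positivity : 0 ≤ c + ε / 2)
      linarith
    have h5 : ‖T ((C ^ m) x)‖ ^ 2 / N + K * t ≤ (c + ε / 2) * ‖y‖ ^ 2 := by
      have h6 : ‖T ((C ^ m) x)‖ ^ 2 / N ≤ c + 1 / N * t := by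
        rw [hc, one_div_mul_eq_div, ← add_div]
        exact div_le_div_of_nonneg_right hlt.le hN0.le
      linarith
    have h7 := hC.norm_propagator_sq_ge (A := t ^ (2 * m) * (c + ε / 2)) ht0.le hy0
      (hJ.trans (by
        rw [mul_assoc]
        exact mul_le_mul_of_nonneg_left h5 (by positivity)))
    rw [htu] at h7
    by_contra! hcon
    have h8 : ‖propagator C t‖ ^ 2 < (1 - (c + ε) * u) ^ 2 :=
      pow_lt_pow_left₀ hcon (norm_nonneg _) two_ne_zero
    have h9 := mul_le_mul_of_nonneg_right hu1 hu0.le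
    linarith [show (1 - (c + ε) * u) ^ 2 = 1 - 2 * ((c + ε) * u) + (c + ε) ^ 2 * u * u by ring]
  rw [Real.norm_eq_abs, Real.norm_eq_abs, abs_of_pos hu0, abs_le]
  constructor <;> linarith

theorem eventually_abs_le_of_isLittleO {f : ℝ → ℝ} {c a ε : ℝ} (hε : 0 < ε)
    (h : (fun t : ℝ => f t - (1 - c * t ^ a)) =o[𝓝[>] 0] (fun t : ℝ => t ^ a)) :
    ∀ᶠ t : ℝ in 𝓝[>] 0, 1 - (c + ε) * t ^ a ≤ f t ∧ f t ≤ 1 - (c - ε) * t ^ a := by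
  filter_upwards [Asymptotics.isLittleO_iff.1 h hε, self_mem_nhdsWithin] with t ht ht0
  have hu : 0 < t ^ a := Real.rpow_pos_of_pos ht0 a
  rw [Real.norm_eq_abs, Real.norm_eq_abs, abs_of_pos hu, abs_le] at ht
  constructor <;> linarith [ht.1, ht.2]

/-- A function bounded above by `1 - c t ^ a` near zero cannot exceed `1 - K t ^ b` for `a < b`. -/
theorem exponent_le_of_eventually_le {f : ℝ → ℝ} {c a K b : ℝ} (hc : 0 < c)
    (hf : ∀ᶠ t : ℝ in 𝓝[>] 0, f t ≤ 1 - c * t ^ a)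
    (hg : ∀ᶠ t : ℝ in 𝓝[>] 0, 1 - K * t ^ b ≤ f t) : b ≤ a := by
  by_contra! hab
  have h0 : Tendsto (fun t : ℝ => K * t ^ (b - a)) (𝓝[>] 0) (𝓝 0) := by
    have h1 : ContinuousAt (fun t : ℝ => t ^ (b - a)) 0 :=
      Real.continuousAt_rpow_const _ _ (Or.inr (by linarith))
    have h2 := (h1.tendsto.mono_left (nhdsWithin_le_nhds (s := Set.Ioi 0))).const_mul K
    simpa [Real.zero_rpow (by linarith : b - a ≠ 0)] using h2
  obtain ⟨t, ⟨⟨h1, h2⟩, h3⟩, ht0⟩ :=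
    (((hf.and hg).and (h0.eventually (gt_mem_nhds hc))).and self_mem_nhdsWithin).exists
  have ht0 : 0 < t := ht0
  have hu : 0 < t ^ a := Real.rpow_pos_of_pos ht0 a
  have e : t ^ b = t ^ (b - a) * t ^ a := by rw [← Real.rpow_add ht0, sub_add_cancel]
  rw [e] at h2
  have := mul_lt_mul_of_pos_right h3 hu
  linarith

theorem IsAccretive.norm_propagator_sq_ge_of_not_coerciveUpTo {C : H →L[𝕜] H}
    (hC : IsAccretive C) {m : ℕ} (hm : ¬CoerciveUpTo C m) :
    ∃ K : ℝ, ∀ᶠ t : ℝ in 𝓝[>] 0, 1 - K * t ^ (2 * m + 3) ≤ ‖propagator C t‖ ^ 2 := by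
  set T := opSqrt (hermitianPart C) with hT
  obtain ⟨K, r, hK, hr, h⟩ := sqrt_propagator_taylor T C m
  refine ⟨2 * (m + 1 + K) ^ 2, ?_⟩
  filter_upwards [Ioc_mem_nhdsGT (lt_min hr one_pos)] with t ht
  have ht0 : 0 < t := ht.1
  have htr : t ≤ r := ht.2.trans (min_le_left _ _)
  have ht1 : t ≤ 1 := ht.2.trans (min_le_right _ _)
  obtain ⟨x, hx, hx'⟩ := hC.exists_unit_of_not_coerciveUpTo hm
    (by positivity : 0 < (t ^ (m + 1)) ^ 2)
  have hx0 : x ≠ 0 := norm_pos_iff.1 (by rw [hx]; exact one_pos)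
  have hc := continuous_propagator C
  have hJ : ∫ s in (0 : ℝ)..1, ‖T (propagator C (t * s) x)‖ ^ 2 ≤
      ∫ s in (0 : ℝ)..1, ((m + 1 + K) * t ^ (m + 1)) ^ 2 := by
    refine intervalIntegral.integral_mono_on zero_le_one
      (Continuous.intervalIntegrable (by fun_prop) _ _)
      (Continuous.intervalIntegrable (by fun_prop) _ _) fun s hs => ?_
    refine pow_le_pow_left₀ (norm_nonneg _) ?_ 2
    have h1 := h t ht0.le htr s hs x
    rw [hx, mul_one] at h1
    set Z := ∑ j ∈ Finset.range (m + 1),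
      ((s ^ j : ℝ) : 𝕜) • (((-t) ^ j / j.factorial : ℝ) : 𝕜) • T ((C ^ j) x)
    have h2 : ‖Z‖ ≤ (m + 1) * t ^ (m + 1) := by
      have := norm_sum_le_of_le (Finset.range (m + 1)) (f := fun j =>
        ((s ^ j : ℝ) : 𝕜) • (((-t) ^ j / j.factorial : ℝ) : 𝕜) • T ((C ^ j) x))
        (n := fun _ => t ^ (m + 1)) fun j hj => ?_
      · exact this.trans (le_of_eq (by simp))
      · rw [norm_smul, norm_smul, RCLike.norm_ofReal, RCLike.norm_ofReal, abs_div, abs_pow, abs_pow,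
          abs_neg, Nat.abs_cast, abs_of_nonneg ht0.le, abs_of_nonneg hs.1]
        have h3 : t ^ j / j.factorial ≤ 1 := by
          rw [div_le_one (by positivity)]
          exact (pow_le_one₀ ht0.le ht1).trans
            (by exact_mod_cast Nat.one_le_iff_ne_zero.2 j.factorial_ne_zero)
        have h4 : ‖T ((C ^ j) x)‖ ≤ t ^ (m + 1) :=
          le_of_sq_le_sq (hx' j (Nat.lt_succ_iff.1 (Finset.mem_range.1 hj))) (by positivity)
        calc s ^ j * (t ^ j / j.factorial * ‖T ((C ^ j) x)‖) ≤ 1 * (1 * t ^ (m + 1)) := by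
              gcongr
              exact pow_le_one₀ hs.1 hs.2
          _ = _ := by ring
    have h5 := norm_le_norm_add_norm_sub' (T (propagator C (t * s) x)) Z
    linarith
  simp only [intervalIntegral.integral_const, sub_zero, one_smul] at hJ
  have h6 := hC.norm_propagator_sq_ge ht0.le hx0 (A := ((m + 1 + K) * t ^ (m + 1)) ^ 2)
    (by rw [hx, one_pow, mul_one]; exact hJ)
  refine le_trans (le_of_eq ?_) h6
  ring

/-- Polynomial decay of the propagator norm at short times forces a hypocoercivity index. -/
theorem IsAccretive.exists_index_of_isLittleO {C : H →L[𝕜] H} (hC : IsAccretive C)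
    {c a : ℝ} (hc : 0 < c)
    (h : (fun t : ℝ => ‖propagator C t‖ - (1 - c * t ^ a)) =o[𝓝[>] 0] (fun t : ℝ => t ^ a)) :
    ∃ m : ℕ, HasHypocoercivityIndex C m := by
  classical
  by_cases hex : ∃ m, CoerciveUpTo C m
  · exact ⟨Nat.find hex, Nat.find_spec hex, fun k hk => Nat.find_min' hex hk⟩
  exfalso
  push Not at hex
  obtain ⟨K, hK⟩ := hC.norm_propagator_sq_ge_of_not_coerciveUpTo (hex ⌈a⌉₊)
  have h1 : ∀ᶠ t : ℝ in 𝓝[>] 0, ‖propagator C t‖ ≤ 1 - c / 2 * t ^ a := by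
    filter_upwards [eventually_abs_le_of_isLittleO (half_pos hc) h] with t ht
    rw [sub_half] at ht
    exact ht.2
  have h2 : ∀ᶠ t : ℝ in 𝓝[>] 0,
      1 - K * t ^ ((2 * ⌈a⌉₊ + 3 : ℕ) : ℝ) ≤ ‖propagator C t‖ := by
    filter_upwards [hK, self_mem_nhdsWithin] with t ht ht0
    rw [Real.rpow_natCast]
    refine ht.trans (pow_le_of_le_one (norm_nonneg _) ?_ two_ne_zero)
    exact hC.norm_propagator_le_one (le_of_lt ht0)
  have h3 := exponent_le_of_eventually_le (half_pos hc) h1 h2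
  have h4 := Nat.le_ceil a
  have h5 : (0 : ℝ) ≤ ⌈a⌉₊ := Nat.cast_nonneg _
  push_cast at h3
  linarith

end Main

end Hypocoercivity

theorem mainTheorem1 {𝕜 : Type*} [RCLike 𝕜] {H : Type*} [NormedAddCommGroup H]
    [InnerProductSpace 𝕜 H] [CompleteSpace H] [TopologicalSpace.SeparableSpace H] [Nontrivial H]
    (C : H →L[𝕜] H) (hC : Hypocoercivity.IsAccretive C) :
    (∀ m : ℕ, Hypocoercivity.HasHypocoercivityIndex C m →
      ∃ L c c₁ c₂ C₁ C₂ t₀ : ℝ,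
        Tendsto (Hypocoercivity.constrainedInf C m) (𝓝[>] 0) (𝓝 L) ∧
        c = L / ((Nat.factorial (2 * m + 1) : ℝ) * (Nat.choose (2 * m) m : ℝ)) ∧
        c ≤ c₁ ∧ c₂ ≤ c ∧ 0 < c₂ ∧ 0 ≤ C₁ ∧ 0 ≤ C₂ ∧ 0 < t₀ ∧
        (∀ t : ℝ, 0 ≤ t → t ≤ t₀ →
          1 - c₁ * t ^ (2 * m + 1) - C₁ * t ^ (2 * m + 2) ≤ ‖Hypocoercivity.propagator C t‖ ∧
          ‖Hypocoercivity.propagator C t‖ ≤ 1 - c₂ * t ^ (2 * m + 1) + C₂ * t ^ (2 * m + 2)) ∧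
        (fun t : ℝ => ‖Hypocoercivity.propagator C t‖ - (1 - c * t ^ (2 * m + 1)))
          =o[𝓝[>] 0] (fun t : ℝ => t ^ (2 * m + 1))) ∧
    (∀ c a : ℝ, 0 < c → 0 < a →
      (fun t : ℝ => ‖Hypocoercivity.propagator C t‖ - (1 - c * t ^ a))
        =o[𝓝[>] 0] (fun t : ℝ => t ^ a) →
      ∃ m : ℕ, a = 2 * (m : ℝ) + 1 ∧ Hypocoercivity.IsHypocoercive C ∧
        Hypocoercivity.HasHypocoercivityIndex C m) := by
  constructor
  · intro m hm
    obtain ⟨L, hL0, hL, hL'⟩ := hC.exists_tendsto_constrainedInf hm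
    have hlo := hC.norm_propagator_isLittleO hm hL hL'
    set c : ℝ := L / ((2 * m + 1).factorial * (2 * m).choose m) with hc
    have hc0 : 0 < c := by
      have : 0 < (2 * m).choose m := Nat.choose_pos (by omega)
      positivity
    obtain ⟨t₀, ht₀, hsub⟩ := mem_nhdsGT_iff_exists_Ioc_subset.1
      (Asymptotics.isLittleO_iff.1 hlo (half_pos hc0))
    refine ⟨L, c, 2 * c, c / 2, 0, 0, t₀, hL, rfl, by linarith, by linarith, by linarith, le_rfl,
      le_rfl, ht₀, fun t h0 ht => ?_, hlo⟩
    rcases h0.eq_or_lt with rfl | h0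
    · simp [Hypocoercivity.propagator_zero]
    · have h : ‖‖Hypocoercivity.propagator C t‖ - (1 - c * t ^ (2 * m + 1))‖ ≤
        c / 2 * ‖t ^ (2 * m + 1)‖ := hsub ⟨h0, ht⟩
      have hu : 0 < t ^ (2 * m + 1) := by positivity
      rw [Real.norm_eq_abs, Real.norm_eq_abs, abs_of_pos hu, abs_le] at h
      have := mul_pos hc0 hu
      constructor <;> linarith [h.1, h.2]
  · intro c a hc _ h
    obtain ⟨m, hm⟩ := hC.exists_index_of_isLittleO hc h
    obtain ⟨L, hL0, hL, hL'⟩ := hC.exists_tendsto_constrainedInf hm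
    have hlo := hC.norm_propagator_isLittleO hm hL hL'
    set c' : ℝ := L / ((2 * m + 1).factorial * (2 * m).choose m)
    have hc' : 0 < c' := by
      have : 0 < (2 * m).choose m := Nat.choose_pos (by omega)
      positivity
    simp only [← Real.rpow_natCast _ (2 * m + 1)] at hlo
    have h1 := Hypocoercivity.eventually_abs_le_of_isLittleO (half_pos hc) h
    have h2 := Hypocoercivity.eventually_abs_le_of_isLittleO (half_pos hc') hlo
    rw [sub_half] at h1 h2
    refine ⟨m, le_antisymm ?_ ?_, ?_, hm⟩
    · have := Hypocoercivity.exponent_le_of_eventually_le (half_pos hc') (h2.mono fun _ h => h.2)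
        (h1.mono fun _ h => h.1)
      exact_mod_cast this
    · have := Hypocoercivity.exponent_le_of_eventually_le (half_pos hc) (h1.mono fun _ h => h.2)
        (h2.mono fun _ h => h.1)
      exact_mod_cast this
    · obtain ⟨t, ht, ht0⟩ := (h1.and self_mem_nhdsWithin).exists
      have ht0 : 0 < t := ht0
      have := mul_pos (half_pos hc) (Real.rpow_pos_of_pos ht0 a)
      exact hC.isHypocoercive ht0 (by linarith [ht.2])
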